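/- **Setting.** Write $\mathfrak e(x)=e^{2\pi i x}$, $q^n=\mathfrak e(n\tau)$. Let $V$ be a real vector space of finite dimension $\mathfrak n\ge 1$, $\mathcal V=\mathbb C\otimes_{\mathbb R}V$, $B$ a positive definite symmetric bilinear form on $V$ (extended $\mathbb C$-bilinearly to $\mathcal V$), $Q(x)=\frac12B(x,x)$, and $L\subset V$ a lattice of full rank with $B(L,L)\subseteq\mathbb Z$ (even or odd), with dual lattice $L^\sharp$. Let $\mathcal W$ be a finite-dimensional complex vector space, $k\in\frac12\mathbb Z$ with $k\ne 0,-1,-2,\dots$, and $G\le \mathrm{SL}_2(\mathbb Z)$ a subgroup of finite index with preimage $\widetilde G$ in the metaplectic double cover $\widetilde{\mathrm{SL}}_2(\mathbb Z)$, whose elements are pairs $(\gamma,\varepsilon)$, $\gamma=\begin{pmatrix}a&b\\c&d\end{pmatrix}$, $\varepsilon=\pm1$, standing for $\gamma$ together with the function $\varepsilon\sqrt{c\tau+d}$. Let $H(L,1)$ be the group of all $([v,w],\xi)$ with $v,w\in L$, $\xi=\pm1$ and product $$([v_1,w_1],\xi_1)([v_2,w_2],\xi_2)=([v_1+v_2,w_1+w_2],\xi_1\xi_2e^{\pi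 i(B(v_1,w_2)-B(v_2,w_1))}),$$ on which $\widetilde{\mathrm{SL}}_2(\mathbb Z)$ acts from the right by $[v,w]\gamma=[av+cw,bv+dw]$. An element $g=(\gamma,\varepsilon,[v,w],\xi)$ of $\widetilde{\mathrm{SL}}_2(\mathbb Z)\ltimes H(L,1)$ acts on functions $\phi:\mathbb H\times\mathcal V\to\mathcal W$ by $$(\phi|_{k,B}g)(\tau,z)=(\varepsilon\sqrt{c\tau+d})^{-2k}\,\xi\,\mathfrak e\Big(-\tfrac{c}{c\tau+d}Q(z+\tau v+w)+\tau Q(v)+B(v,z)+\tfrac12B(v,w)\Big)\,\phi\Big(\tfrac{a\tau+b}{c\tau+d},\tfrac{z+\tau v+w}{c\tau+d}\Big).$$ Let $\rho:\widetilde G\ltimes H(L,1)\to \mathrm{GL}(\mathcal W)$ be a representation with kernel of finite index such that $\rho([0,0],-1)=-\mathrm{id}$ and $\rho([v,0],1)=\rho([0,v],1)=\mathrm{id}$ for all $v\in L$. **Jacobi forms.** Consider holomorphic $\phi:\mathbb H\times\mathcal V\to\mathcal W$ with $\phi|_{k,B}g=\rho(g)\circ\phi$ for all $g\in\widetilde G\ltimes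 H(L,1)$ and, for every $g\in\widetilde{\mathrm{SL}}_2(\mathbb Z)\ltimes H(L,1)$, the Fourier expansion $\phi|_{k,B}g=\sum_{n,t}c(n,t)q^n\mathfrak e(B(t,z))$ with $n\in\frac1N\mathbb Z$, $t\in\frac1NL^\sharp$ for some $N\geq 1$. Then $\phi$ is *weakly holomorphic* ($\phi\in J^!_{k,\underline L}(G,\rho)$) if for each $g$ there is $N_0\in\mathbb Q$ with $c(n,t)=0$ unless $n\ge N_0$; a *weak Jacobi form* ($J^{w}_{k,\underline L}(G,\rho)$) if for each $g$, $c(n,t)=0$ unless $n\ge0$; and a *Jacobi form* ($J_{k,\underline L}(G,\rho)$) if for each $g$, $c(n,t)=0$ unless $n-Q(t)\ge0$. For $k'\in\frac12\mathbb Z$ let $M^!_{k'}$, $M_{k'}$, $S_{k'}$ be the spaces of holomorphic $f:\mathbb H\to\mathcal W$ transforming in weight $k'$ under $\widetilde G$ with representation $\rho|_{\widetilde G}$ that are, respectively, meromorphic at all cusps, holomorphic at all cusps, vanishing at all cusps. **Operators.** Let $\mathfrak B=(e_1,\dots,e_{\mathfrak n})$ be an $\mathbb R$-basis of $V$ and let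 $\phi(\tau,\sum z_ie_i)=\sum_{\mathbf j\geq 0}h_{\mathbf j}(\tau)z_1^{j_1}\cdots z_{\mathfrak n}^{j_{\mathfrak n}}$ be the Taylor expansion at $z=0$ (put $h_{\mathbf j}=0$ if some $j_i<0$). Let $s(\mathbf j)=\sum_i j_i$ and let $\mathbf e_i$ be the $i$-th unit vector. On formal series $\sum_{\mathbf j\in\mathbb Z^{\mathfrak n}}h_{\mathbf j}(\tau)T^{\mathbf j}$ let $\mathcal T^{\mathbf p}$ be multiplication by $T^{\mathbf p}$, and let $\mathcal L_k$ map $\sum h_{\mathbf j}T^{\mathbf j}$ to $\sum g_{\mathbf p}T^{\mathbf p}$ with $$g_{\mathbf p}=s(\mathbf p)(s(\mathbf p)+2k-2)h_{\mathbf p}-4\pi i\sum_{i,j}B(e_i,e_j)\tfrac{d}{d\tau}h_{\mathbf p-\mathbf e_i-\mathbf e_j}.$$ Put $\mathcal D_{k,\mathbf p}=\mathcal T^{-\mathbf p}$ if $s(\mathbf p)\in\{0,1\}$, and $\mathcal D_{k,\mathbf p}=\mathcal T^{-\mathbf p}\circ\mathcal L_k$ if $s(\mathbf p)=2$. Then $D_{k,\mathbf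 p}\phi$ is the constant term of $\mathcal D_{k,\mathbf p}\big(\sum_{s(\mathbf j)\equiv s(\mathbf p)\,(2)}h_{\mathbf j}T^{\mathbf j}\big)$. Let $\mathbf p_1=(0,\dots,0,1)$ and $\mathbf p_2=(0,\dots,0,2)$. **Statement.** (1) Suppose $|L^\sharp/L|=3$ and let $\alpha+L$ be a generator of $L^\sharp/L$. Suppose that there is a $w\in\alpha+L$ at which $Q$ attains its minimum on $\alpha+L$ and with $B(w,e_{\mathfrak n})\ne0$, and that $\sum_{v\in L}B(\alpha+v,e_{\mathfrak n})q^{Q(\alpha+v)}$ is not identically zero on $\mathbb H$. Then $\phi\mapsto(D_{k,\mathbf 0}\phi,D_{k,\mathbf p_1}\phi,D_{k,\mathbf p_2}\phi)$ defines $\mathbb C$-linear embeddings $$J^!_{k,\underline L}(G,\rho)\to M^!_k\times M^!_{k+1}\times M^!_{k+2},\quad J^{w}_{k,\underline L}(G,\rho)\to M_k\times M_{k+1}\times M_{k+2},\quad J_{k,\underline L}(G,\rho)\to M_k\times S_{k+1}\times S_{k+2}.$$ (2) Suppose $|L^\sharp/L|=2$ and $L^\sharp/L=\{0+L,\alpha+L\}$.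 Suppose that there is a $w\in\alpha+L$ at which $Q$ attains its minimum on $\alpha+L$ and with $B(w,e_{\mathfrak n})\neq0$. Then $\phi\mapsto(D_{k,\mathbf 0}\phi,D_{k,\mathbf p_2}\phi)$ defines $\mathbb C$-linear embeddings $$J^!_{k,\underline L}(G,\rho)\to M^!_k\times M^!_{k+2},\quad J^{w}_{k,\underline L}(G,\rho)\to M_k\times M_{k+2},\quad J_{k,\underline L}(G,\rho)\to M_k\times S_{k+2}.$$ -/

import Mathlib

open scoped UpperHalfPlane TensorProduct MatrixGroups

set_option linter.unusedSectionVars false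

noncomputable section

namespace JacobiTaylor

/-! ### The metaplectic double cover of `SL(2, ℤ)` -/

/-- The exponential `exp (2 π i x)`. -/
def expo (x : ℂ) : ℂ := Complex.exp (2 * Real.pi * Complex.I * x)

/-- The factor `c τ + d`. -/
def autFactor (γ : SL(2, ℤ)) (τ : ℍ) : ℂ := ((γ 1 0 : ℤ) : ℂ) * (τ : ℂ) + ((γ 1 1 : ℤ) : ℂ)

theorem autFactor_eq_denom (γ : SL(2, ℤ)) (τ : ℍ) :
    autFactor γ τ = UpperHalfPlane.denom (γ : GL (Fin 2) ℝ) τ := by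
  simp [autFactor, UpperHalfPlane.denom]

theorem autFactor_ne_zero (γ : SL(2, ℤ)) (τ : ℍ) : autFactor γ τ ≠ 0 := by
  rw [autFactor_eq_denom]; exact UpperHalfPlane.denom_ne_zero _ _

theorem autFactor_mul (γ δ : SL(2, ℤ)) (τ : ℍ) :
    autFactor (γ * δ) τ = autFactor γ (δ • τ) * autFactor δ τ := by
  simp only [autFactor_eq_denom, map_mul]
  exact UpperHalfPlane.denom_cocycle_σ _ _ _ |>.trans (by
    simp [UpperHalfPlane.σ])

theorem continuous_smul_SL (γ : SL(2, ℤ)) : Continuous fun τ : ℍ => γ • τ :=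
  continuous_const_smul (γ : GL (Fin 2) ℝ)

/-- Elements of the double cover of `SL(2, ℤ)`: a matrix together with a choice of a continuous
square root of `c τ + d` on the upper half plane, that is, one of the two functions
`± (c τ + d) ^ (1 / 2)`. -/
@[ext] structure Mp where
  mat : SL(2, ℤ)
  rt : ℍ → ℂ
  cont : Continuous rt
  sq : ∀ τ, rt τ ^ 2 = autFactor mat τ

namespace Mp

theorem rt_ne_zero (g : Mp) (τ : ℍ) : g.rt τ ≠ 0 := by
  intro h
  have := g.sq τ
  rw [h] at this
  exact autFactor_ne_zero g.mat τ (by simpa using this.symm)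

instance : One Mp := ⟨⟨1, fun _ => 1, continuous_const, fun τ => by simp [autFactor]⟩⟩

instance : Mul Mp := ⟨fun g h =>
  ⟨g.mat * h.mat, fun τ => g.rt (h.mat • τ) * h.rt τ,
    (g.cont.comp (continuous_smul_SL h.mat)).mul h.cont, fun τ => by
      rw [mul_pow, g.sq, h.sq, autFactor_mul]⟩⟩

instance : Inv Mp := ⟨fun g =>
  ⟨g.mat⁻¹, fun τ => (g.rt (g.mat⁻¹ • τ))⁻¹,
    (g.cont.comp (continuous_smul_SL g.mat⁻¹)).inv₀ fun _ => g.rt_ne_zero _, fun τ => by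
      rw [inv_pow, g.sq]
      have h := autFactor_mul g.mat g.mat⁻¹ τ
      rw [mul_inv_cancel] at h
      have h1 : autFactor 1 τ = 1 := by simp [autFactor]
      rw [h1] at h
      exact (eq_inv_of_mul_eq_one_right h.symm).symm⟩⟩

@[simp] theorem one_mat : (1 : Mp).mat = 1 := rfl
@[simp] theorem one_rt (τ : ℍ) : (1 : Mp).rt τ = 1 := rfl
@[simp] theorem mul_mat (g h : Mp) : (g * h).mat = g.mat * h.mat := rfl
@[simp] theorem mul_rt (g h : Mp) (τ : ℍ) : (g * h).rt τ = g.rt (h.mat • τ) * h.rt τ := rfl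
@[simp] theorem inv_mat (g : Mp) : (g⁻¹).mat = g.mat⁻¹ := rfl
@[simp] theorem inv_rt (g : Mp) (τ : ℍ) : (g⁻¹).rt τ = (g.rt (g.mat⁻¹ • τ))⁻¹ := rfl

instance : Group Mp where
  mul_assoc a b c := by
    ext τ
    · simp [mul_assoc]
    · simp [mul_assoc, mul_smul]
  one_mul a := by ext τ <;> simp
  mul_one a := by ext τ <;> simp
  inv_mul_cancel a := by
    ext τ
    · simp
    · simp [rt_ne_zero]

/-- The projection from the double cover to `SL(2, ℤ)`. -/
def proj : Mp →* SL(2, ℤ) where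
  toFun := Mp.mat
  map_one' := rfl
  map_mul' _ _ := rfl

end Mp

/-- The preimage of a subgroup of `SL(2, ℤ)` in the double cover. -/
def mpLift (G : Subgroup SL(2, ℤ)) : Subgroup Mp := G.comap Mp.proj

/-! ### Lattices and the Jacobi group -/

/-- An integral lattice in a real vector space with a positive definite symmetric bilinear
form. -/
structure IntegralLattice (V : Type*) [AddCommGroup V] [Module ℝ V] where
  /-- the bilinear form on the ambient real vector space -/
  B : LinearMap.BilinForm ℝ V
  symm : ∀ v w, B v w = B w v
  posDef : ∀ v, v ≠ 0 → 0 < B v v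
  /-- the lattice -/
  L : AddSubgroup V
  isLattice : ∃ (m : ℕ) (b : Module.Basis (Fin m) ℝ V), L = AddSubgroup.closure (Set.range b)
  integral : ∀ v ∈ L, ∀ w ∈ L, ∃ n : ℤ, B v w = n

variable {V : Type*} [AddCommGroup V] [Module ℝ V]

namespace IntegralLattice

variable (Λ : IntegralLattice V)

/-- The quadratic form `Q v = B (v, v) / 2`. -/
def Q (v : V) : ℝ := Λ.B v v / 2

/-- The complex bilinear extension of `B` to the complexification of `V`. -/
def BC : LinearMap.BilinForm ℂ (ℂ ⊗[ℝ] V) := LinearMap.BilinForm.baseChange ℂ Λ.B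

/-- The extension of `Q` to the complexification of `V`. -/
def QC (z : ℂ ⊗[ℝ] V) : ℂ := Λ.BC z z / 2

/-- The dual lattice. -/
def dual : AddSubgroup V where
  carrier := {v | ∀ w ∈ Λ.L, ∃ n : ℤ, Λ.B v w = n}
  zero_mem' := fun w _ => ⟨0, by simp⟩
  add_mem' := by
    intro a b ha hb w hw
    obtain ⟨m, hm⟩ := ha w hw
    obtain ⟨n, hn⟩ := hb w hw
    exact ⟨m + n, by simp [hm, hn]⟩
  neg_mem' := by
    intro a ha w hw
    obtain ⟨m, hm⟩ := ha w hw
    exact ⟨-m, by simp [hm]⟩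

/-- The discriminant group, dual lattice modulo lattice. -/
abbrev Disc : Type _ := Λ.dual ⧸ Λ.L.addSubgroupOf Λ.dual

/-- The alternating form `A ([v₁, w₁], [v₂, w₂]) = B (v₁, w₂) - B (v₂, w₁)`. -/
def A (v₁ w₁ v₂ w₂ : V) : ℝ := Λ.B v₁ w₂ - Λ.B v₂ w₁

end IntegralLattice

/-- Elements `(γ, [v, w], ξ)` of the semidirect product of the double cover of `SL(2, ℤ)` with the
real Heisenberg group of `(V, B)`. -/
@[ext] structure JacobiElt (Λ : IntegralLattice V) where
  mp : Mp
  v : V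
  w : V
  ξ : Circle

namespace JacobiElt

variable {Λ : IntegralLattice V}

/-- The component `a v + c w` of `[v, w] γ`. -/
def actV (γ : SL(2, ℤ)) (v w : V) : V := γ 0 0 • v + γ 1 0 • w

/-- The component `b v + d w` of `[v, w] γ`. -/
def actW (γ : SL(2, ℤ)) (v w : V) : V := γ 0 1 • v + γ 1 1 • w

instance : One (JacobiElt Λ) := ⟨⟨1, 0, 0, 1⟩⟩

instance : Mul (JacobiElt Λ) := ⟨fun g h =>
  ⟨g.mp * h.mp, actV h.mp.mat g.v g.w + h.v, actW h.mp.mat g.v g.w + h.w,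
    g.ξ * h.ξ * Circle.exp (Real.pi *
      Λ.A (actV h.mp.mat g.v g.w) (actW h.mp.mat g.v g.w) h.v h.w)⟩⟩

instance : Inv (JacobiElt Λ) := ⟨fun g =>
  ⟨g.mp⁻¹, -actV g.mp.mat⁻¹ g.v g.w, -actW g.mp.mat⁻¹ g.v g.w, g.ξ⁻¹⟩⟩

@[simp] theorem one_mp : (1 : JacobiElt Λ).mp = 1 := rfl
@[simp] theorem one_v : (1 : JacobiElt Λ).v = 0 := rfl
@[simp] theorem one_w : (1 : JacobiElt Λ).w = 0 := rfl
@[simp] theorem one_ξ : (1 : JacobiElt Λ).ξ = 1 := rfl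
@[simp] theorem mul_mp (g h : JacobiElt Λ) : (g * h).mp = g.mp * h.mp := rfl
@[simp] theorem mul_v (g h : JacobiElt Λ) : (g * h).v = actV h.mp.mat g.v g.w + h.v := rfl
@[simp] theorem mul_w (g h : JacobiElt Λ) : (g * h).w = actW h.mp.mat g.v g.w + h.w := rfl
theorem mul_ξ (g h : JacobiElt Λ) : (g * h).ξ = g.ξ * h.ξ * Circle.exp (Real.pi *
      Λ.A (actV h.mp.mat g.v g.w) (actW h.mp.mat g.v g.w) h.v h.w) := rfl
@[simp] theorem inv_mp (g : JacobiElt Λ) : (g⁻¹).mp = g.mp⁻¹ := rfl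
@[simp] theorem inv_v (g : JacobiElt Λ) : (g⁻¹).v = -actV g.mp.mat⁻¹ g.v g.w := rfl
@[simp] theorem inv_w (g : JacobiElt Λ) : (g⁻¹).w = -actW g.mp.mat⁻¹ g.v g.w := rfl
@[simp] theorem inv_ξ (g : JacobiElt Λ) : (g⁻¹).ξ = g.ξ⁻¹ := rfl

@[simp] theorem actV_one (v w : V) : actV 1 v w = v := by simp [actV]
@[simp] theorem actW_one (v w : V) : actW 1 v w = w := by simp [actW]

theorem actV_mul (γ δ : SL(2, ℤ)) (v w : V) :
    actV (γ * δ) v w = actV δ (actV γ v w) (actW γ v w) := by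
  simp only [actV, actW, Matrix.SpecialLinearGroup.coe_mul, Matrix.mul_apply, Fin.sum_univ_two]
  module

theorem actW_mul (γ δ : SL(2, ℤ)) (v w : V) :
    actW (γ * δ) v w = actW δ (actV γ v w) (actW γ v w) := by
  simp only [actV, actW, Matrix.SpecialLinearGroup.coe_mul, Matrix.mul_apply, Fin.sum_univ_two]
  module

theorem actV_add (γ : SL(2, ℤ)) (v w v' w' : V) :
    actV γ (v + v') (w + w') = actV γ v w + actV γ v' w' := by simp only [actV]; module

theorem actW_add (γ : SL(2, ℤ)) (v w v' w' : V) :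
    actW γ (v + v') (w + w') = actW γ v w + actW γ v' w' := by simp only [actW]; module

theorem actV_neg (γ : SL(2, ℤ)) (v w : V) : actV γ (-v) (-w) = -actV γ v w := by
  simp only [actV]; module

theorem actW_neg (γ : SL(2, ℤ)) (v w : V) : actW γ (-v) (-w) = -actW γ v w := by
  simp only [actW]; module

theorem A_act (Λ : IntegralLattice V) (γ : SL(2, ℤ)) (v w v' w' : V) :
    Λ.A (actV γ v w) (actW γ v w) (actV γ v' w') (actW γ v' w') = Λ.A v w v' w' := by
  have hdet : ((γ 0 0 : ℤ) : ℝ) * (γ 1 1 : ℤ) - ((γ 0 1 : ℤ) : ℝ) * (γ 1 0 : ℤ) = 1 := by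
    have := γ.det_coe
    rw [Matrix.det_fin_two] at this
    exact_mod_cast this
  simp only [IntegralLattice.A, actV, actW, map_add, map_zsmul, LinearMap.add_apply,
    LinearMap.smul_apply, zsmul_eq_mul]
  rw [Λ.symm v' v, Λ.symm w' v, Λ.symm v' w, Λ.symm w' w]
  linear_combination (Λ.B v w' - Λ.B w v') * hdet

theorem A_add_left (Λ : IntegralLattice V) (v₁ w₁ v₂ w₂ v w : V) :
    Λ.A (v₁ + v₂) (w₁ + w₂) v w = Λ.A v₁ w₁ v w + Λ.A v₂ w₂ v w := by
  simp [IntegralLattice.A]; ring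

theorem A_add_right (Λ : IntegralLattice V) (v₁ w₁ v₂ w₂ v w : V) :
    Λ.A v w (v₁ + v₂) (w₁ + w₂) = Λ.A v w v₁ w₁ + Λ.A v w v₂ w₂ := by
  simp [IntegralLattice.A]; ring

instance : Group (JacobiElt Λ) where
  mul_assoc a b c := by
    ext1
    · simp [mul_assoc]
    · simp [actV_mul, actV_add, add_assoc]
    · simp [actW_mul, actW_add, add_assoc]
    · simp only [mul_ξ, mul_mp, Mp.mul_mat, mul_v, mul_w, actV_mul, actW_mul, actV_add, actW_add,
        A_add_left, A_add_right, mul_add, Circle.exp_add]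
      rw [A_act]
      simp only [mul_assoc, mul_left_comm, mul_comm]
  one_mul a := by
    ext1
    · simp
    · simp [actV]
    · simp [actW]
    · simp [mul_ξ, actV, actW, IntegralLattice.A]
  mul_one a := by
    ext1
    · simp
    · simp
    · simp
    · simp [mul_ξ, IntegralLattice.A]
  inv_mul_cancel a := by
    have h1 : actV a.mp.mat (a⁻¹).v (a⁻¹).w = -a.v := by
      rw [inv_v, inv_w, actV_neg, ← actV_mul, inv_mul_cancel, actV_one]
    have h2 : actW a.mp.mat (a⁻¹).v (a⁻¹).w = -a.w := by
      rw [inv_v, inv_w, actW_neg, ← actW_mul, inv_mul_cancel, actW_one]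
    ext1
    · simp
    · rw [mul_v, h1]; simp
    · rw [mul_w, h2]; simp
    · rw [mul_ξ, h1, h2]; simp [IntegralLattice.A]

end JacobiElt

theorem actV_mem {L : AddSubgroup V} (γ : SL(2, ℤ)) {v w : V} (hv : v ∈ L) (hw : w ∈ L) :
    JacobiElt.actV γ v w ∈ L := L.add_mem (L.zsmul_mem hv _) (L.zsmul_mem hw _)

theorem actW_mem {L : AddSubgroup V} (γ : SL(2, ℤ)) {v w : V} (hv : v ∈ L) (hw : w ∈ L) :
    JacobiElt.actW γ v w ∈ L := L.add_mem (L.zsmul_mem hv _) (L.zsmul_mem hw _)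

theorem circle_exp_int_sq (n : ℤ) : Circle.exp (Real.pi * n) ^ 2 = 1 := by
  rw [← Circle.exp_nsmul, Circle.exp_eq_one]
  exact ⟨n, by simp; ring⟩

/-- The Jacobi group: triples `(γ, [v, w], ξ)` with `γ` above `G`, `v, w ∈ L` and `ξ ^ 2 = 1`. -/
def jacobiGroup (Λ : IntegralLattice V) (G : Subgroup SL(2, ℤ)) : Subgroup (JacobiElt Λ) where
  carrier := {g | g.mp ∈ mpLift G ∧ g.v ∈ Λ.L ∧ g.w ∈ Λ.L ∧ g.ξ ^ 2 = 1}
  one_mem' := ⟨(mpLift G).one_mem, Λ.L.zero_mem, Λ.L.zero_mem, by simp⟩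
  mul_mem' := by
    rintro g h ⟨g1, g2, g3, g4⟩ ⟨h1, h2, h3, h4⟩
    refine ⟨(mpLift G).mul_mem g1 h1, Λ.L.add_mem (actV_mem _ g2 g3) h2,
      Λ.L.add_mem (actW_mem _ g2 g3) h3, ?_⟩
    obtain ⟨m, hm⟩ := Λ.integral _ (actV_mem h.mp.mat g2 g3) _ h3
    obtain ⟨n, hn⟩ := Λ.integral _ h2 _ (actW_mem h.mp.mat g2 g3)
    have : Λ.A (JacobiElt.actV h.mp.mat g.v g.w) (JacobiElt.actW h.mp.mat g.v g.w) h.v h.w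
        = ((m - n : ℤ) : ℝ) := by
      simp [IntegralLattice.A, hm, hn]
    rw [JacobiElt.mul_ξ, this, mul_pow, mul_pow, g4, h4, circle_exp_int_sq]
    simp
  inv_mem' := by
    rintro g ⟨g1, g2, g3, g4⟩
    refine ⟨(mpLift G).inv_mem g1, Λ.L.neg_mem (actV_mem _ g2 g3),
      Λ.L.neg_mem (actW_mem _ g2 g3), ?_⟩
    simp [g4]

/-- The element `([v, w], ξ)` of the Heisenberg group of `L`, as an element of the Jacobi group. -/
def heis (Λ : IntegralLattice V) (G : Subgroup SL(2, ℤ)) (v w : Λ.L) (ξ : Circle)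
    (hξ : ξ ^ 2 = 1) : jacobiGroup Λ G :=
  ⟨⟨1, v, w, ξ⟩, (mpLift G).one_mem, v.2, w.2, hξ⟩

/-- The embedding of the preimage of `G` in the double cover into the Jacobi group. -/
def mpEmbed (Λ : IntegralLattice V) (G : Subgroup SL(2, ℤ)) : mpLift G →* jacobiGroup Λ G where
  toFun g := ⟨⟨g, 0, 0, 1⟩, g.2, Λ.L.zero_mem, Λ.L.zero_mem, by simp⟩
  map_one' := rfl
  map_mul' g h := by
    apply Subtype.ext
    ext1 <;> simp [JacobiElt.mul_ξ, JacobiElt.actV, JacobiElt.actW, IntegralLattice.A]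

variable {W : Type*} [NormedAddCommGroup W] [NormedSpace ℂ W]

/-! ### Vector-valued modular forms of weight `κ / 2` -/

/-- The slash operator of weight `κ / 2` on functions on the upper half plane. -/
def modSlash (κ : ℤ) (g : Mp) (f : ℍ → W) (τ : ℍ) : W := (g.rt τ) ^ (-κ) • f (g.mat • τ)

/-- Holomorphy of functions on the upper half plane. -/
def HoloH (f : ℍ → W) : Prop :=
  DifferentiableOn ℂ (fun x : ℂ => f (UpperHalfPlane.ofComplex x)) {x | 0 < x.im}

/-- `f` has an absolutely convergent expansion `∑ a(n) q ^ n`, where `n` runs over rational numbers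
with bounded denominators that satisfy the condition `P`. -/
def HasQExp (P : ℚ → Prop) (f : ℍ → W) : Prop :=
  ∃ (N : ℕ) (a : ℚ → W), 0 < N ∧ (∀ n, a n ≠ 0 → (∃ m : ℤ, n * N = m) ∧ P n) ∧
    ∀ τ : ℍ, HasSum (fun n : ℚ => expo (n * τ) • a n) (f τ)

theorem HasQExp.mono {P P' : ℚ → Prop} (h : ∀ n, P n → P' n) {f : ℍ → W} (hf : HasQExp P f) :
    HasQExp P' f := by
  obtain ⟨N, a, hN, ha, hs⟩ := hf
  exact ⟨N, a, hN, fun n hn => ⟨(ha n hn).1, h n (ha n hn).2⟩, hs⟩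

theorem HasQExp.zero (P : ℚ → Prop) : HasQExp P (0 : ℍ → W) :=
  ⟨1, 0, one_pos, fun n hn => absurd rfl hn, fun τ => by simp⟩

theorem HasQExp.add {P : ℚ → Prop} {f f' : ℍ → W} (hf : HasQExp P f) (hf' : HasQExp P f') :
    HasQExp P (f + f') := by
  obtain ⟨N, a, hN, ha, hs⟩ := hf
  obtain ⟨N', a', hN', ha', hs'⟩ := hf'
  refine ⟨N * N', a + a', Nat.mul_pos hN hN', fun n hn => ?_, fun τ => ?_⟩
  · by_cases h : a n = 0
    · obtain ⟨⟨m, hm⟩, hP⟩ := ha' n (by intro h'; exact hn (by simp [h, h']))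
      exact ⟨⟨m * N, by push_cast; linear_combination (N : ℚ) * hm⟩, hP⟩
    · obtain ⟨⟨m, hm⟩, hP⟩ := ha n h
      exact ⟨⟨m * N', by push_cast; linear_combination (N' : ℚ) * hm⟩, hP⟩
  · simpa [smul_add] using (hs τ).add (hs' τ)

theorem HasQExp.smul {P : ℚ → Prop} {f : ℍ → W} (hf : HasQExp P f) (x : ℂ) :
    HasQExp P (x • f) := by
  obtain ⟨N, a, hN, ha, hs⟩ := hf
  refine ⟨N, x • a, hN, fun n hn => ha n (by rintro h; exact hn (by simp [h])), fun τ => ?_⟩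
  simpa only [Pi.smul_apply, smul_comm x] using (hs τ).const_smul x

theorem modSlash_zero (κ : ℤ) (g : Mp) : modSlash κ g (0 : ℍ → W) = 0 := by
  funext τ; simp [modSlash]

theorem modSlash_add (κ : ℤ) (g : Mp) (f f' : ℍ → W) :
    modSlash κ g (f + f') = modSlash κ g f + modSlash κ g f' := by
  funext τ; simp [modSlash]

theorem modSlash_smul (κ : ℤ) (g : Mp) (x : ℂ) (f : ℍ → W) :
    modSlash κ g (x • f) = x • modSlash κ g f := by
  funext τ; simp only [modSlash, Pi.smul_apply]; rw [smul_comm]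

/-- Holomorphic functions that transform like a modular form of weight `κ / 2` on the preimage of
`G` in the double cover, with representation `σ`. -/
def modFormHol (κ : ℤ) (G : Subgroup SL(2, ℤ)) (σ : Representation ℂ (mpLift G) W) :
    Submodule ℂ (ℍ → W) where
  carrier := {f | HoloH f ∧ ∀ g : mpLift G, ∀ τ, modSlash κ g f τ = σ g (f τ)}
  zero_mem' := ⟨differentiableOn_const _, fun g τ => by simp [modSlash_zero]⟩
  add_mem' := by
    rintro f f' ⟨h1, h2⟩ ⟨h1', h2'⟩
    exact ⟨DifferentiableOn.add h1 h1', fun g τ => by simp [modSlash_add, h2, h2']⟩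
  smul_mem' := by
    rintro x f ⟨h1, h2⟩
    exact ⟨DifferentiableOn.const_smul h1 x, fun g τ => by simp [modSlash_smul, h2]⟩

/-- Modular forms that are meromorphic at all cusps. -/
def modFormWHol (κ : ℤ) (G : Subgroup SL(2, ℤ)) (σ : Representation ℂ (mpLift G) W) :
    Submodule ℂ (ℍ → W) where
  carrier := {f | f ∈ modFormHol κ G σ ∧
    ∀ g : Mp, ∃ n₀ : ℚ, HasQExp (fun n => n₀ ≤ n) (modSlash κ g f)}
  zero_mem' := ⟨zero_mem _, fun g => ⟨0, by rw [modSlash_zero]; exact HasQExp.zero _⟩⟩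
  add_mem' := by
    rintro f f' ⟨h1, h2⟩ ⟨h1', h2'⟩
    refine ⟨add_mem h1 h1', fun g => ?_⟩
    obtain ⟨n, hn⟩ := h2 g
    obtain ⟨n', hn'⟩ := h2' g
    refine ⟨min n n', ?_⟩
    rw [modSlash_add]
    exact (hn.mono fun m hm => (min_le_left _ _).trans hm).add
      (hn'.mono fun m hm => (min_le_right _ _).trans hm)
  smul_mem' := by
    rintro x f ⟨h1, h2⟩
    refine ⟨Submodule.smul_mem _ x h1, fun g => ?_⟩
    obtain ⟨n, hn⟩ := h2 g
    exact ⟨n, by rw [modSlash_smul]; exact hn.smul x⟩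

/-- Holomorphic functions with modular transformation laws all of whose expansions at the cusps are
supported on exponents satisfying `P`. -/
def modFormOf (P : ℚ → Prop) (κ : ℤ) (G : Subgroup SL(2, ℤ))
    (σ : Representation ℂ (mpLift G) W) : Submodule ℂ (ℍ → W) where
  carrier := {f | f ∈ modFormHol κ G σ ∧ ∀ g : Mp, HasQExp P (modSlash κ g f)}
  zero_mem' := ⟨zero_mem _, fun g => by rw [modSlash_zero]; exact HasQExp.zero _⟩
  add_mem' := by
    rintro f f' ⟨h1, h2⟩ ⟨h1', h2'⟩
    exact ⟨add_mem h1 h1', fun g => by rw [modSlash_add]; exact (h2 g).add (h2' g)⟩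
  smul_mem' := by
    rintro x f ⟨h1, h2⟩
    exact ⟨Submodule.smul_mem _ x h1, fun g => by rw [modSlash_smul]; exact (h2 g).smul x⟩

/-- Modular forms (holomorphic at all cusps). -/
def modForm (κ : ℤ) (G : Subgroup SL(2, ℤ)) (σ : Representation ℂ (mpLift G) W) :
    Submodule ℂ (ℍ → W) := modFormOf (fun n => 0 ≤ n) κ G σ

/-- Cusp forms (vanishing at all cusps). -/
def cuspForm (κ : ℤ) (G : Subgroup SL(2, ℤ)) (σ : Representation ℂ (mpLift G) W) :
    Submodule ℂ (ℍ → W) := modFormOf (fun n => 0 < n) κ G σ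

/-! ### Jacobi forms of lattice index and weight `κ / 2` -/

/-- The point `τ v + w` of the complexification of `V`. -/
def torsionPt (τ : ℍ) (v w : V) : ℂ ⊗[ℝ] V := (τ : ℂ) ⊗ₜ[ℝ] v + (1 : ℂ) ⊗ₜ[ℝ] w

/-- The automorphic factor `J_B (g, (τ, z))`. -/
def jacobiFactor (Λ : IntegralLattice V) (g : JacobiElt Λ) (τ : ℍ) (z : ℂ ⊗[ℝ] V) : ℂ :=
  (g.ξ : ℂ) * expo (-(((g.mp.mat 1 0 : ℤ) : ℂ) / autFactor g.mp.mat τ)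
      * Λ.QC (z + torsionPt τ g.v g.w)
    + τ * Λ.Q g.v + Λ.BC ((1 : ℂ) ⊗ₜ[ℝ] g.v) z + Λ.B g.v g.w / 2)

/-- The slash operator of weight `κ / 2` and form `B`. -/
def jacobiSlash (Λ : IntegralLattice V) (κ : ℤ) (g : JacobiElt Λ)
    (φ : ℍ × (ℂ ⊗[ℝ] V) → W) (x : ℍ × (ℂ ⊗[ℝ] V)) : W :=
  ((g.mp.rt x.1) ^ (-κ) * jacobiFactor Λ g x.1 x.2) •
    φ (g.mp.mat • x.1, (autFactor g.mp.mat x.1)⁻¹ • (x.2 + torsionPt x.1 g.v g.w))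

/-- The point with complex coordinates `z` in the basis `b`. -/
def coordPt {m : ℕ} (b : Module.Basis (Fin m) ℝ V) (z : Fin m → ℂ) : ℂ ⊗[ℝ] V :=
  ∑ i, (z i) ⊗ₜ[ℝ] (b i)

/-- Joint holomorphy of a function on the product of the upper half plane and the complexification
of `V`, read in linear coordinates. -/
def HoloJ (φ : ℍ × (ℂ ⊗[ℝ] V) → W) : Prop :=
  ∀ (m : ℕ) (b : Module.Basis (Fin m) ℝ V),
    DifferentiableOn ℂ (fun x : ℂ × (Fin m → ℂ) => φ (UpperHalfPlane.ofComplex x.1, coordPt b x.2))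
      {x | 0 < x.1.im}

/-- `f` has an absolutely convergent expansion `∑ c(n, t) q ^ n e(B (t, z))`, where for some positive
integer `N` the sum is over `n ∈ (1 / N) ℤ` and `t` in `1 / N` times the dual lattice that satisfy
the condition `P`. -/
def HasJExp (Λ : IntegralLattice V) (P : ℚ → V → Prop) (f : ℍ × (ℂ ⊗[ℝ] V) → W) : Prop :=
  ∃ (N : ℕ) (c : ℚ × V → W), 0 < N ∧
    (∀ n t, c (n, t) ≠ 0 → (∃ m : ℤ, n * N = m) ∧ N • t ∈ Λ.dual ∧ P n t) ∧
    ∀ (τ : ℍ) (z : ℂ ⊗[ℝ] V), HasSum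
      (fun p : ℚ × V => expo (p.1 * τ + Λ.BC ((1 : ℂ) ⊗ₜ[ℝ] p.2) z) • c p) (f (τ, z))

theorem HasJExp.mono {Λ : IntegralLattice V} {P P' : ℚ → V → Prop}
    (h : ∀ n t, P n t → P' n t) {f : ℍ × (ℂ ⊗[ℝ] V) → W} (hf : HasJExp Λ P f) :
    HasJExp Λ P' f := by
  obtain ⟨N, a, hN, ha, hs⟩ := hf
  exact ⟨N, a, hN, fun n t hn => ⟨(ha n t hn).1, (ha n t hn).2.1, h n t (ha n t hn).2.2⟩, hs⟩

theorem HasJExp.zero (Λ : IntegralLattice V) (P : ℚ → V → Prop) :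
    HasJExp Λ P (0 : ℍ × (ℂ ⊗[ℝ] V) → W) :=
  ⟨1, 0, one_pos, fun n t hn => absurd rfl hn, fun τ z => by simp⟩

theorem HasJExp.add {Λ : IntegralLattice V} {P : ℚ → V → Prop} {f f' : ℍ × (ℂ ⊗[ℝ] V) → W}
    (hf : HasJExp Λ P f) (hf' : HasJExp Λ P f') : HasJExp Λ P (f + f') := by
  obtain ⟨N, a, hN, ha, hs⟩ := hf
  obtain ⟨N', a', hN', ha', hs'⟩ := hf'
  refine ⟨N * N', a + a', Nat.mul_pos hN hN', fun n t hn => ?_, fun τ z => ?_⟩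
  · by_cases h : a (n, t) = 0
    · obtain ⟨⟨m, hm⟩, ht, hP⟩ := ha' n t (by intro h'; exact hn (by simp [h, h']))
      exact ⟨⟨m * N, by push_cast; linear_combination (N : ℚ) * hm⟩,
        by rw [mul_smul]; exact Λ.dual.nsmul_mem ht N, hP⟩
    · obtain ⟨⟨m, hm⟩, ht, hP⟩ := ha n t h
      exact ⟨⟨m * N', by push_cast; linear_combination (N' : ℚ) * hm⟩,
        by rw [mul_comm, mul_smul]; exact Λ.dual.nsmul_mem ht N', hP⟩
  · simpa [smul_add] using (hs τ z).add (hs' τ z)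

theorem HasJExp.smul {Λ : IntegralLattice V} {P : ℚ → V → Prop} {f : ℍ × (ℂ ⊗[ℝ] V) → W}
    (hf : HasJExp Λ P f) (x : ℂ) : HasJExp Λ P (x • f) := by
  obtain ⟨N, a, hN, ha, hs⟩ := hf
  refine ⟨N, x • a, hN, fun n t hn => ha n t (by rintro h; exact hn (by simp [h])), fun τ z => ?_⟩
  simpa only [Pi.smul_apply, smul_comm x] using (hs τ z).const_smul x

theorem jacobiSlash_zero (Λ : IntegralLattice V) (κ : ℤ) (g : JacobiElt Λ) :
    jacobiSlash Λ κ g (0 : ℍ × (ℂ ⊗[ℝ] V) → W) = 0 := by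
  funext x; simp [jacobiSlash]

theorem jacobiSlash_add (Λ : IntegralLattice V) (κ : ℤ) (g : JacobiElt Λ)
    (f f' : ℍ × (ℂ ⊗[ℝ] V) → W) :
    jacobiSlash Λ κ g (f + f') = jacobiSlash Λ κ g f + jacobiSlash Λ κ g f' := by
  funext x; simp [jacobiSlash]

theorem jacobiSlash_smul (Λ : IntegralLattice V) (κ : ℤ) (g : JacobiElt Λ) (a : ℂ)
    (f : ℍ × (ℂ ⊗[ℝ] V) → W) : jacobiSlash Λ κ g (a • f) = a • jacobiSlash Λ κ g f := by
  funext x; simp only [jacobiSlash, Pi.smul_apply]; rw [smul_comm]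

/-- Holomorphic functions that transform like a Jacobi form of weight `κ / 2` and index `(L, B)`
under `G` with representation `ρ`. -/
def jacobiFormHol (Λ : IntegralLattice V) (κ : ℤ) (G : Subgroup SL(2, ℤ))
    (ρ : Representation ℂ (jacobiGroup Λ G) W) : Submodule ℂ (ℍ × (ℂ ⊗[ℝ] V) → W) where
  carrier := {φ | HoloJ φ ∧
    ∀ g : jacobiGroup Λ G, ∀ x, jacobiSlash Λ κ (g : JacobiElt Λ) φ x = ρ g (φ x)}
  zero_mem' := ⟨fun _ _ => differentiableOn_const _, fun g x => by simp [jacobiSlash_zero]⟩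
  add_mem' := by
    rintro f f' ⟨h1, h2⟩ ⟨h1', h2'⟩
    exact ⟨fun m b => DifferentiableOn.add (h1 m b) (h1' m b), fun g x => by
      simp [jacobiSlash_add, h2, h2']⟩
  smul_mem' := by
    rintro a f ⟨h1, h2⟩
    exact ⟨fun m b => DifferentiableOn.const_smul (h1 m b) a, fun g x => by
      simp [jacobiSlash_smul, h2]⟩

/-- Weakly holomorphic Jacobi forms. -/
def jacobiFormWHol (Λ : IntegralLattice V) (κ : ℤ) (G : Subgroup SL(2, ℤ))
    (ρ : Representation ℂ (jacobiGroup Λ G) W) : Submodule ℂ (ℍ × (ℂ ⊗[ℝ] V) → W) where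
  carrier := {φ | φ ∈ jacobiFormHol Λ κ G ρ ∧
    ∀ g ∈ jacobiGroup Λ ⊤, ∃ n₀ : ℚ, HasJExp Λ (fun n _ => n₀ ≤ n) (jacobiSlash Λ κ g φ)}
  zero_mem' := ⟨zero_mem _, fun g _ => ⟨0, by rw [jacobiSlash_zero]; exact HasJExp.zero _ _⟩⟩
  add_mem' := by
    rintro f f' ⟨h1, h2⟩ ⟨h1', h2'⟩
    refine ⟨add_mem h1 h1', fun g hg => ?_⟩
    obtain ⟨n, hn⟩ := h2 g hg
    obtain ⟨n', hn'⟩ := h2' g hg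
    refine ⟨min n n', ?_⟩
    rw [jacobiSlash_add]
    exact (hn.mono fun m _ hm => (min_le_left _ _).trans hm).add
      (hn'.mono fun m _ hm => (min_le_right _ _).trans hm)
  smul_mem' := by
    rintro x f ⟨h1, h2⟩
    refine ⟨Submodule.smul_mem _ x h1, fun g hg => ?_⟩
    obtain ⟨n, hn⟩ := h2 g hg
    exact ⟨n, by rw [jacobiSlash_smul]; exact hn.smul x⟩

/-- Holomorphic functions with Jacobi transformation laws such that the expansions of all their
transforms under the full Jacobi group are supported on pairs `(n, t)` satisfying `P`. -/
def jacobiFormOf (Λ : IntegralLattice V) (P : ℚ → V → Prop) (κ : ℤ) (G : Subgroup SL(2, ℤ))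
    (ρ : Representation ℂ (jacobiGroup Λ G) W) : Submodule ℂ (ℍ × (ℂ ⊗[ℝ] V) → W) where
  carrier := {φ | φ ∈ jacobiFormHol Λ κ G ρ ∧
    ∀ g ∈ jacobiGroup Λ ⊤, HasJExp Λ P (jacobiSlash Λ κ g φ)}
  zero_mem' := ⟨zero_mem _, fun g _ => by rw [jacobiSlash_zero]; exact HasJExp.zero _ _⟩
  add_mem' := by
    rintro f f' ⟨h1, h2⟩ ⟨h1', h2'⟩
    exact ⟨add_mem h1 h1', fun g hg => by rw [jacobiSlash_add]; exact (h2 g hg).add (h2' g hg)⟩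
  smul_mem' := by
    rintro x f ⟨h1, h2⟩
    exact ⟨Submodule.smul_mem _ x h1, fun g hg => by
      rw [jacobiSlash_smul]; exact (h2 g hg).smul x⟩

/-- Weak Jacobi forms. -/
def jacobiFormWeak (Λ : IntegralLattice V) (κ : ℤ) (G : Subgroup SL(2, ℤ))
    (ρ : Representation ℂ (jacobiGroup Λ G) W) : Submodule ℂ (ℍ × (ℂ ⊗[ℝ] V) → W) :=
  jacobiFormOf Λ (fun n _ => 0 ≤ n) κ G ρ

/-- Jacobi forms. -/
def jacobiForm (Λ : IntegralLattice V) (κ : ℤ) (G : Subgroup SL(2, ℤ))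
    (ρ : Representation ℂ (jacobiGroup Λ G) W) : Submodule ℂ (ℍ × (ℂ ⊗[ℝ] V) → W) :=
  jacobiFormOf Λ (fun n t => 0 ≤ (n : ℝ) - Λ.Q t) κ G ρ

/-! ### Taylor expansions and the operators `D_{k, p}` -/

/-- The partial derivative in the `i`-th variable. -/
def partialDeriv {m : ℕ} (i : Fin m) (f : (Fin m → ℂ) → W) (z : Fin m → ℂ) : W :=
  lineDeriv ℂ f z (Pi.single i 1)

/-- The iterated partial derivative `∂ ^ p`. -/
def multiDeriv {m : ℕ} (p : Fin m → ℕ) (f : (Fin m → ℂ) → W) : (Fin m → ℂ) → W :=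
  (List.finRange m).foldr (fun i F => (partialDeriv i)^[p i] F) f

/-- Formal series `∑ h_j(τ) T ^ j` with `j ∈ ℤ ^ m`, given by their coefficients. -/
abbrev FormalSer (m : ℕ) (W : Type*) : Type _ := (Fin m → ℤ) → ℍ → W

/-- The Taylor expansion of `φ (τ, z₁ e₁ + ⋯ + z_m e_m)` around `z = 0`, as a formal series. -/
def taylorSer {m : ℕ} (b : Module.Basis (Fin m) ℝ V) (φ : ℍ × (ℂ ⊗[ℝ] V) → W) :
    FormalSer m W := fun j τ =>
  if ∀ i, 0 ≤ j i then
    (((∏ i, (j i).toNat.factorial : ℕ) : ℂ)⁻¹) •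
      multiDeriv (fun i => (j i).toNat) (fun z => φ (τ, coordPt b z)) 0
  else 0

/-- The operator `T ^ p` of multiplication by the monomial with exponent `p`. -/
def monomialMul {m : ℕ} (p : Fin m → ℤ) (h : FormalSer m W) : FormalSer m W := fun j => h (j - p)

/-- The derivative with respect to `τ`. -/
def dTau (f : ℍ → W) (τ : ℍ) : W := deriv (fun x : ℂ => f (UpperHalfPlane.ofComplex x)) (τ : ℂ)

/-- The modified heat operator `ℒ_k` with respect to the basis `b`, for `k = κ / 2`. -/
def heatOp (Λ : IntegralLattice V) {m : ℕ} (b : Module.Basis (Fin m) ℝ V) (κ : ℤ)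
    (h : FormalSer m W) : FormalSer m W := fun p τ =>
  (((∑ i, p i) * ((∑ i, p i) + κ - 2) : ℤ) : ℂ) • h p τ -
    (4 * Real.pi * Complex.I : ℂ) •
      ∑ i, ∑ j, (Λ.B (b i) (b j) : ℂ) • dTau (h (p - Pi.single i 1 - Pi.single j 1)) τ

/-- The composition `T ^ (-p_{l-1}) ∘ ℒ_{k+2(l-1)} ∘ ⋯ ∘ T ^ (-p_1) ∘ ℒ_{k+2} ∘ T ^ (-p_0) ∘ ℒ_k`,
for `k = κ / 2` and the list `[p_0, …, p_{l-1}]`. -/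
def raiseList (Λ : IntegralLattice V) {m : ℕ} (b : Module.Basis (Fin m) ℝ V) :
    ℤ → List (Fin m → ℤ) → FormalSer m W → FormalSer m W
  | _, [], h => h
  | κ, p :: ps, h => raiseList Λ b (κ + 4) ps (monomialMul (-p) (heatOp Λ b κ h))

/-- A decomposition of `p` with `∑ p_i = 2 l` into `l` vectors with coordinate sum `2` (the operator
`raiseList` depends only on the sum `p` of these vectors). -/
def splitEven {n : ℕ} (l : ℕ) (p : Fin (n + 1) → ℤ) : List (Fin (n + 1) → ℤ) :=
  match l with
  | 0 => []
  | l + 1 => (p - Pi.single (Fin.last n) (2 * (l : ℤ))) ::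
      List.replicate l (Pi.single (Fin.last n) 2)

/-- The operator `𝒟_{k, p}` on formal series, for `k = κ / 2` and a vector `p` with
nonnegative coordinate sum. -/
def calD (Λ : IntegralLattice V) {n : ℕ} (b : Module.Basis (Fin (n + 1)) ℝ V) (κ : ℤ)
    (p : Fin (n + 1) → ℤ) (h : FormalSer (n + 1) W) : FormalSer (n + 1) W :=
  if ∑ i, p i = 0 ∨ ∑ i, p i = 1 then monomialMul (-p) h
  else if Even (∑ i, p i) then
    raiseList Λ b κ (splitEven ((∑ i, p i) / 2).toNat p) h
  else
    raiseList Λ b (κ + 2)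
      (splitEven ((∑ i, p i) / 2).toNat (p - Pi.single (Fin.last n) 1))
      (monomialMul (-Pi.single (Fin.last n) 1) h)

/-- The operator `D_{k, p}` on functions, for `k = κ / 2`: the constant term of `𝒟_{k, p}` applied to
the part of the Taylor expansion of `φ` with total degrees of the same parity as `p`. -/
def opD (Λ : IntegralLattice V) {n : ℕ} (b : Module.Basis (Fin (n + 1)) ℝ V) (κ : ℤ)
    (p : Fin (n + 1) → ℤ) (φ : ℍ × (ℂ ⊗[ℝ] V) → W) : ℍ → W :=
  calD Λ b κ p
    (fun j τ => if (∑ i, j i) % 2 = (∑ i, p i) % 2 then taylorSer b φ j τ else 0) 0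

end JacobiTaylor

end

open JacobiTaylor

noncomputable section

namespace JacobiTaylor

/-! ### Absolutely convergent exponential sums -/

section ExpSums

variable {ι : Type*} {W : Type*} [NormedAddCommGroup W] [NormedSpace ℂ W]

/-! For fixed `τ`, write `φ(τ, z) = ∑ C(t) e(B(t, z))`. Invariance under translation of `z` by `L`
forces `C` to live on the dual lattice. The transformation law under `τ L` says that `C(t) e(-τ
Q(t))` depends only on the coset `t + L`. This is the theta decomposition, and it leaves as many
unknowns as there are elements of `L^♯/L` (`fiberCoeff_mem_dual`, `fiberCoeff_add`).

With `e` the last basis vector, `D_{k,0}` and `D_{k,p₁}` are, up to nonzero constants, the moments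
`∑ B(t, e)^j C(t)` for `j = 0, 1`. Once `D_{k,0} φ = 0`, the heat term of `D_{k,p₂}` drops out, and
`k ≠ 0` makes it a multiple of the second moment. If all of them vanish, the unknowns solve a
homogeneous linear system whose entries are the theta series `∑ B(a + v, e)^j q^{Q(a + v)}`
(`IsRepSystem.sum_theta_smul`). For two cosets the determinant is `thetaDet`. For the three cosets
`0, α, -α`, the substitution `v ↦ -v` splits the system: the odd equation equates the unknowns of
`α` and `-α` wherever the first-order theta series is nonzero, and the two even equations again have
determinant `thetaDet` up to a factor `2`. High up the imaginary axis the product containing the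
minimal vector `w` dominates, so `thetaDet` is not identically zero (`exists_thetaDet_ne_zero`). The
identity theorem then gives `φ = 0`.

That the values are modular forms rests on how the jets behave under the slash operator: on a line
through `0` it multiplies by a Gaussian and rescales (`HasJSum.opD_one_slash`,
`HasJSum.opD_two_slash`). The operators act on double series diagonally, by weights depending on
`(n, t)` (`IsJetOp`), so conditions at the cusps can be read off from supports. Cuspidality holds
because the weights of `D_{k,p₁}` and `D_{k,p₂}` vanish at `(0, 0)`, the only pair with `n ≥ Q(t)`
and `n ≤ 0`. -/

theorem norm_expo (z : ℂ) : ‖expo z‖ = Real.exp (-(2 * Real.pi * z.im)) := by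
  rw [expo, Complex.norm_exp]
  congr 1
  simp [mul_assoc]

theorem expo_add (x y : ℂ) : expo (x + y) = expo x * expo y := by
  rw [expo, expo, expo, ← Complex.exp_add]; congr 1; ring

theorem expo_zero : expo 0 = 1 := by simp [expo]

theorem expo_ne_zero (x : ℂ) : expo x ≠ 0 := Complex.exp_ne_zero _

theorem hasDerivAt_expo (x : ℂ) : HasDerivAt expo ((2 * Real.pi * Complex.I) * expo x) x := by
  have h := ((hasDerivAt_id x).const_mul (2 * Real.pi * Complex.I : ℂ)).cexp
  have e : expo = fun z => Complex.exp (2 * Real.pi * Complex.I * z) := rfl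
  rw [e]
  simpa [mul_comm] using h

/-- Absolute convergence of the sum `∑ c_i e(ν_i x + ξ_i s)` for all `x` in the upper half plane
and all complex `s`. -/
def ExpSummable (ν ξ : ι → ℝ) (c : ι → W) : Prop :=
  ∀ y : ℝ, 0 < y → ∀ s : ℝ,
    Summable fun i => Real.exp (2 * Real.pi * (s * ξ i - y * ν i)) * ‖c i‖

/-- The exponential sum `∑ c_i e(ν_i x + ξ_i s)`. -/
def expSum (ν ξ : ι → ℝ) (c : ι → W) (x s : ℂ) : W := ∑' i, expo (ν i * x + s * ξ i) • c i

variable {ν ξ : ι → ℝ} {c : ι → W}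

theorem norm_expo_term (ν ξ : ℝ) (x s : ℂ) :
    ‖expo (ν * x + s * ξ)‖ = Real.exp (2 * Real.pi * ((-s.im) * ξ - x.im * ν)) := by
  rw [norm_expo]; congr 1; simp; ring

theorem ExpSummable.summable_norm (h : ExpSummable ν ξ c) {x : ℂ} (hx : 0 < x.im) (s : ℂ) :
    Summable fun i => ‖expo (ν i * x + s * ξ i) • c i‖ := by
  simpa only [norm_smul, norm_expo_term] using h x.im hx (-s.im)

theorem ExpSummable.hasSum [CompleteSpace W] (h : ExpSummable ν ξ c) {x : ℂ} (hx : 0 < x.im)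
    (s : ℂ) : HasSum (fun i => expo (ν i * x + s * ξ i) • c i) (expSum ν ξ c x s) :=
  (h.summable_norm hx s).of_norm.hasSum

theorem abs_le_exp_add_exp (u : ℝ) : |u| ≤ Real.exp u + Real.exp (-u) := by
  have h1 := Real.add_one_le_exp u
  have h2 := Real.add_one_le_exp (-u)
  have h3 := Real.exp_pos u
  have h4 := Real.exp_pos (-u)
  rw [abs_le]; constructor <;> linarith

/-- The exponential is monotone in `t`, so one of the two endpoints always dominates. This gives a
bound uniform over a strip that does not depend on the sign of `u`. -/
theorem exp_mul_le_add {a b t u : ℝ} (h1 : a ≤ t) (h2 : t ≤ b) :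
    Real.exp (t * u) ≤ Real.exp (a * u) + Real.exp (b * u) := by
  rcases le_total 0 u with hu | hu
  · have : Real.exp (t * u) ≤ Real.exp (b * u) := Real.exp_le_exp.2 (by nlinarith)
    linarith [Real.exp_pos (a * u)]
  · have : Real.exp (t * u) ≤ Real.exp (a * u) := Real.exp_le_exp.2 (by nlinarith)
    linarith [Real.exp_pos (b * u)]

/-- A factor `ξ` is dominated by `e^{2πξ} + e^{-2πξ}`, that is, by moving `s` to `s ± 1`, where
convergence is also assumed. Thus termwise differentiation never leaves the class of admissible
series. -/
theorem ExpSummable.smul_snd (h : ExpSummable ν ξ c) (a : ℂ) :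
    ExpSummable ν ξ fun i => (a * ξ i) • c i := by
  intro y hy s
  refine Summable.of_nonneg_of_le (fun i => by positivity) (fun i => ?_)
    (((h y hy (s + 1)).add (h y hy (s - 1))).mul_left ‖a‖)
  have h1 := abs_le_exp_add_exp (2 * Real.pi * ξ i)
  have h2 : |ξ i| ≤ |2 * Real.pi * ξ i| := by
    rw [abs_mul, abs_of_pos (by positivity : 0 < 2 * Real.pi)]
    nlinarith [abs_nonneg (ξ i), Real.pi_gt_three]
  have e1 : Real.exp (2 * Real.pi * ((s + 1) * ξ i - y * ν i)) =
      Real.exp (2 * Real.pi * (s * ξ i - y * ν i)) * Real.exp (2 * Real.pi * ξ i) := by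
    rw [← Real.exp_add]; congr 1; ring
  have e2 : Real.exp (2 * Real.pi * ((s - 1) * ξ i - y * ν i)) =
      Real.exp (2 * Real.pi * (s * ξ i - y * ν i)) * Real.exp (-(2 * Real.pi * ξ i)) := by
    rw [← Real.exp_add]; congr 1; ring
  rw [norm_smul, norm_mul, Complex.norm_real, Real.norm_eq_abs, e1, e2]
  calc _ = ‖a‖ * (Real.exp (2 * Real.pi * (s * ξ i - y * ν i)) * |ξ i| * ‖c i‖) := by ring
    _ ≤ ‖a‖ * (Real.exp (2 * Real.pi * (s * ξ i - y * ν i)) *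
        (Real.exp (2 * Real.pi * ξ i) + Real.exp (-(2 * Real.pi * ξ i))) * ‖c i‖) := by
      gcongr; exact h2.trans h1
    _ = _ := by ring

/-- The factor `ν` is absorbed by changing the height: `π y |ν| ≤ e^{πyν} + e^{-πyν}` replaces `y`
by `y/2` and `3y/2`, both still positive. -/
theorem ExpSummable.smul_fst (h : ExpSummable ν ξ c) (a : ℂ) :
    ExpSummable ν ξ fun i => (a * ν i) • c i := by
  intro y hy s
  refine Summable.of_nonneg_of_le (fun i => by positivity) (fun i => ?_)
    (((h (y / 2) (by positivity) s).add (h (3 * y / 2) (by positivity) s)).mul_left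
      (‖a‖ * (Real.pi * y)⁻¹))
  have h1 := abs_le_exp_add_exp (Real.pi * y * ν i)
  rw [abs_mul, abs_of_pos (by positivity : 0 < Real.pi * y)] at h1
  have e1 : Real.exp (2 * Real.pi * (s * ξ i - y / 2 * ν i)) =
      Real.exp (2 * Real.pi * (s * ξ i - y * ν i)) * Real.exp (Real.pi * y * ν i) := by
    rw [← Real.exp_add]; congr 1; ring
  have e2 : Real.exp (2 * Real.pi * (s * ξ i - 3 * y / 2 * ν i)) =
      Real.exp (2 * Real.pi * (s * ξ i - y * ν i)) * Real.exp (-(Real.pi * y * ν i)) := by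
    rw [← Real.exp_add]; congr 1; ring
  rw [norm_smul, norm_mul, Complex.norm_real, Real.norm_eq_abs, e1, e2]
  calc _ = ‖a‖ * (Real.pi * y)⁻¹ * (Real.exp (2 * Real.pi * (s * ξ i - y * ν i)) *
        (Real.pi * y * |ν i|) * ‖c i‖) := by field_simp
    _ ≤ ‖a‖ * (Real.pi * y)⁻¹ * (Real.exp (2 * Real.pi * (s * ξ i - y * ν i)) *
        (Real.exp (Real.pi * y * ν i) + Real.exp (-(Real.pi * y * ν i))) * ‖c i‖) := by
      gcongr
    _ = _ := by ring

/-- By Weierstrass, a summable bound on the holomorphic terms themselves suffices; none is needed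
for their derivatives. -/
theorem hasDerivAt_tsum_of_le [CompleteSpace W] {F F' : ι → ℂ → W} {U : Set ℂ} {u : ι → ℝ}
    (hu : Summable u) (hU : IsOpen U) (hF : ∀ i, ∀ w ∈ U, HasDerivAt (F i) (F' i w) w)
    (hle : ∀ i, ∀ w ∈ U, ‖F i w‖ ≤ u i) {z : ℂ} (hz : z ∈ U) :
    HasDerivAt (fun w => ∑' i, F i w) (∑' i, F' i z) z := by
  have hd : ∀ i, DifferentiableOn ℂ (F i) U := fun i w hw =>
    (hF i w hw).differentiableAt.differentiableWithinAt
  have h1 := Complex.differentiableOn_tsum_of_summable_norm hu hd hU hle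
  have h2 := Complex.hasSum_deriv_of_summable_norm hu hd hU hle hz
  have h3 := (h1.differentiableAt (hU.mem_nhds hz)).hasDerivAt
  rw [← h2.tsum_eq] at h3
  convert h3 using 3 with i
  exact (hF i z hz).deriv.symm

theorem ExpSummable.hasDerivAt_fst [CompleteSpace W] (h : ExpSummable ν ξ c) {x : ℂ}
    (hx : 0 < x.im) (s : ℂ) :
    HasDerivAt (fun x => expSum ν ξ c x s)
      (expSum ν ξ (fun i => (2 * Real.pi * Complex.I * ν i) • c i) x s) x := by
  have hU : IsOpen {w : ℂ | x.im / 2 < w.im ∧ w.im < 2 * x.im} :=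
    (isOpen_lt continuous_const Complex.continuous_im).inter
      (isOpen_lt Complex.continuous_im continuous_const)
  -- On this horizontal strip each term is at most the sum of its sizes at the two bounding heights.
  refine hasDerivAt_tsum_of_le (U := {w : ℂ | x.im / 2 < w.im ∧ w.im < 2 * x.im})
    (F := fun i w => expo (ν i * w + s * ξ i) • c i)
    (F' := fun i w => expo (ν i * w + s * ξ i) • (2 * Real.pi * Complex.I * ν i) • c i)
    ((h (x.im / 2) (by positivity) (-s.im)).add (h (2 * x.im) (by positivity) (-s.im)))
    hU (fun i w _ => ?_) (fun i w hw => ?_) (z := x) ⟨by linarith, by linarith⟩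
  · have h1 := ((hasDerivAt_expo (ν i * w + s * ξ i)).comp w
      (((hasDerivAt_id w).const_mul (ν i : ℂ)).add_const (s * ξ i))).smul_const (c i)
    refine h1.congr_deriv ?_
    rw [smul_smul]; congr 1; ring
  · rw [norm_smul, norm_expo_term, ← add_mul]
    refine mul_le_mul_of_nonneg_right ?_ (norm_nonneg _)
    have := exp_mul_le_add (u := -(2 * Real.pi * ν i)) hw.1.le hw.2.le
    have e : ∀ y : ℝ, Real.exp (2 * Real.pi * ((-s.im) * ξ i - y * ν i)) =
        Real.exp (2 * Real.pi * ((-s.im) * ξ i)) * Real.exp (y * (-(2 * Real.pi * ν i))) := by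
      intro y; rw [← Real.exp_add]; congr 1; ring
    rw [e, e, e, ← mul_add]
    exact mul_le_mul_of_nonneg_left this (Real.exp_pos _).le

theorem ExpSummable.hasDerivAt_snd [CompleteSpace W] (h : ExpSummable ν ξ c) {x : ℂ}
    (hx : 0 < x.im) (s : ℂ) :
    HasDerivAt (fun s => expSum ν ξ c x s)
      (expSum ν ξ (fun i => (2 * Real.pi * Complex.I * ξ i) • c i) x s) s := by
  have hU : IsOpen {w : ℂ | s.im - 1 < w.im ∧ w.im < s.im + 1} :=
    (isOpen_lt continuous_const Complex.continuous_im).inter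
      (isOpen_lt Complex.continuous_im continuous_const)
  refine hasDerivAt_tsum_of_le (U := {w : ℂ | s.im - 1 < w.im ∧ w.im < s.im + 1})
    (F := fun i w => expo (ν i * x + w * ξ i) • c i)
    (F' := fun i w => expo (ν i * x + w * ξ i) • (2 * Real.pi * Complex.I * ξ i) • c i)
    ((h x.im hx (-(s.im - 1))).add (h x.im hx (-(s.im + 1))))
    hU (fun i w _ => ?_) (fun i w hw => ?_) (z := s) ⟨by linarith, by linarith⟩
  · have h1 := ((hasDerivAt_expo (ν i * x + w * ξ i)).comp w
      (((hasDerivAt_id w).mul_const (ξ i : ℂ)).const_add (ν i * x))).smul_const (c i)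
    refine h1.congr_deriv ?_
    rw [smul_smul]; congr 1; ring
  · rw [norm_smul, norm_expo_term, ← add_mul]
    refine mul_le_mul_of_nonneg_right ?_ (norm_nonneg _)
    have := exp_mul_le_add (u := -(2 * Real.pi * ξ i)) hw.1.le hw.2.le
    have e : ∀ y : ℝ, Real.exp (2 * Real.pi * ((-y) * ξ i - x.im * ν i)) =
        Real.exp (-(2 * Real.pi * (x.im * ν i))) * Real.exp (y * (-(2 * Real.pi * ξ i))) := by
      intro y; rw [← Real.exp_add]; congr 1; ring
    rw [e, e, e, ← mul_add]
    exact mul_le_mul_of_nonneg_left this (Real.exp_pos _).le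

end ExpSums

/-! ### The operators of degree at most two -/

section Operators

variable {V : Type*} [AddCommGroup V] [Module ℝ V]
variable {W : Type*} [NormedAddCommGroup W] [NormedSpace ℂ W]
variable (Λ : IntegralLattice V) {n : ℕ} (b : Module.Basis (Fin (n + 1)) ℝ V) (κ : ℤ)
  (φ : ℍ × (ℂ ⊗[ℝ] V) → W)

theorem multiDeriv_single {m : ℕ} (i : Fin m) (k : ℕ) (f : (Fin m → ℂ) → W) :
    multiDeriv (fun j => if j = i then k else 0) f = (partialDeriv i)^[k] f := by
  have : ∀ l : List (Fin m), l.Nodup →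
      l.foldr (fun j F => (partialDeriv j)^[if j = i then k else 0] F) f =
        if i ∈ l then (partialDeriv i)^[k] f else f := by
    intro l
    induction l with
    | nil => simp
    | cons a l ih =>
      intro hl
      rw [List.nodup_cons] at hl
      rw [List.foldr_cons, ih hl.2]
      by_cases h : a = i
      · subst h; simp [hl.1]
      · have h' : i ≠ a := fun e => h e.symm
        simp [h, h']
  rw [multiDeriv, this _ (List.nodup_finRange m)]
  simp

theorem coordPt_smul_single {m : ℕ} (b : Module.Basis (Fin m) ℝ V) (i : Fin m) (s : ℂ) :
    coordPt b (Pi.single i s) = s ⊗ₜ[ℝ] b i := by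
  rw [coordPt, Finset.sum_eq_single i]
  · simp
  · intro j _ hj; simp [hj]
  · simp

theorem coordPt_zero {m : ℕ} (b : Module.Basis (Fin m) ℝ V) : coordPt b 0 = 0 := by
  simp [coordPt]

theorem partialDeriv_single {m : ℕ} (i : Fin m) (f : (Fin m → ℂ) → W) (s : ℂ) :
    partialDeriv i f (Pi.single i s) = deriv (fun t => f (Pi.single i t)) s := by
  rw [partialDeriv, lineDeriv]
  have : (fun t : ℂ => f (Pi.single i s + t • Pi.single i 1)) =
      fun t => (fun u => f (Pi.single i u)) (s + t) := by
    funext t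
    simp [← Pi.single_smul', ← Pi.single_add]
  rw [this, deriv_comp_const_add (fun u => f (Pi.single i u)), add_zero]

theorem taylorSer_zero (τ : ℍ) : taylorSer b φ 0 τ = φ (τ, 0) := by
  have := multiDeriv_single (Fin.last n) 0 (fun z => φ (τ, coordPt b z))
  simp only [ite_self] at this
  simp [taylorSer, this, coordPt_zero]

theorem taylorSer_single_one (τ : ℍ) : taylorSer b φ (Pi.single (Fin.last n) 1) τ =
    deriv (fun s : ℂ => φ (τ, s ⊗ₜ[ℝ] b (Fin.last n))) 0 := by
  have h0 : ∀ i, 0 ≤ (Pi.single (Fin.last n) 1 : Fin (n + 1) → ℤ) i := by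
    intro i; rw [Pi.single_apply]; split_ifs <;> simp
  have h1 : ∀ i, ((Pi.single (Fin.last n) 1 : Fin (n + 1) → ℤ) i).toNat =
      if i = Fin.last n then 1 else 0 := by
    intro i; rw [Pi.single_apply]; split_ifs <;> simp
  rw [taylorSer, if_pos h0]
  simp only [h1]
  rw [multiDeriv_single, Finset.prod_eq_one]
  · have := partialDeriv_single (Fin.last n) (fun z => φ (τ, coordPt b z)) 0
    simp only [Pi.single_zero, coordPt_smul_single] at this
    simp [this]
  · intro i _; split_ifs <;> simp

theorem taylorSer_single_two (τ : ℍ) : taylorSer b φ (Pi.single (Fin.last n) 2) τ =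
    (2 : ℂ)⁻¹ • deriv (deriv fun s : ℂ => φ (τ, s ⊗ₜ[ℝ] b (Fin.last n))) 0 := by
  have h0 : ∀ i, 0 ≤ (Pi.single (Fin.last n) 2 : Fin (n + 1) → ℤ) i := by
    intro i; rw [Pi.single_apply]; split_ifs <;> simp
  have h1 : ∀ i, ((Pi.single (Fin.last n) 2 : Fin (n + 1) → ℤ) i).toNat =
      if i = Fin.last n then 2 else 0 := by
    intro i; rw [Pi.single_apply]; split_ifs <;> simp
  rw [taylorSer, if_pos h0]
  simp only [h1]
  rw [multiDeriv_single, Finset.prod_eq_single (Fin.last n)]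
  · have := partialDeriv_single (Fin.last n)
      (partialDeriv (Fin.last n) (fun z => φ (τ, coordPt b z))) 0
    simp only [partialDeriv_single, Pi.single_zero, coordPt_smul_single] at this
    simp [this]
  · intro i _ hi; simp [hi]
  · simp

theorem taylorSer_neg {j : Fin (n + 1) → ℤ} (i : Fin (n + 1)) (hj : j i < 0) :
    taylorSer b φ j = 0 := by
  funext τ
  rw [taylorSer, if_neg]
  · rfl
  · intro h; exact absurd (h i) (not_le.2 hj)

theorem opD_zero (τ : ℍ) : opD Λ b κ 0 φ τ = φ (τ, 0) := by
  simp [opD, calD, monomialMul, taylorSer_zero]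

theorem opD_single_one (τ : ℍ) : opD Λ b κ (Pi.single (Fin.last n) 1) φ τ =
    deriv (fun s : ℂ => φ (τ, s ⊗ₜ[ℝ] b (Fin.last n))) 0 := by
  simp [opD, calD, monomialMul, taylorSer_single_one, Finset.sum_pi_single']

/-- The factor `2 (2 + 2k - 2) = 4k = 2κ` of the heat operator meets the Taylor coefficient, half of
the second derivative, and leaves `κ`. -/
theorem opD_single_two (τ : ℍ) : opD Λ b κ (Pi.single (Fin.last n) 2) φ τ =
    (κ : ℂ) • deriv (deriv fun s : ℂ => φ (τ, s ⊗ₜ[ℝ] b (Fin.last n))) 0 -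
      (4 * Real.pi * Complex.I * Λ.B (b (Fin.last n)) (b (Fin.last n)) : ℂ) •
        dTau (fun τ => φ (τ, 0)) τ := by
  have hs : ∑ i, (Pi.single (Fin.last n) 2 : Fin (n + 1) → ℤ) i = 2 := by
    simp [Finset.sum_pi_single']
  have hd0 : dTau (0 : ℍ → W) τ = 0 := by simp [dTau]
  -- Any other pair makes some exponent negative, so only one term of the double sum survives.
  have key : ∀ i j : Fin (n + 1), (i, j) ≠ (Fin.last n, Fin.last n) →
      taylorSer b φ (Pi.single (Fin.last n) 2 - Pi.single i 1 - Pi.single j 1) = 0 := by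
    intro i j hij
    by_cases hi : i = Fin.last n
    · have hj : j ≠ Fin.last n := by rintro rfl; exact hij (by rw [hi])
      refine taylorSer_neg b φ j ?_
      subst hi
      simp [hj]
    · refine taylorSer_neg b φ i ?_
      by_cases hj : i = j
      · subst hj; simp [hi]
      · simp [hi, hj]
  have hval : taylorSer b φ (Pi.single (Fin.last n) 2 - Pi.single (Fin.last n) 1
      - Pi.single (Fin.last n) 1) = fun τ => φ (τ, 0) := by
    funext τ
    rw [← taylorSer_zero b φ τ]
    congr 1
    rw [sub_sub, ← Pi.single_add, one_add_one_eq_two, sub_self]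
  simp only [opD, calD, hs]
  norm_num
  simp only [splitEven, List.replicate_zero, raiseList, monomialMul, sub_neg_eq_add, zero_add,
    CharP.cast_eq_zero, mul_zero, Pi.single_zero, sub_zero, heatOp, hs]
  have hsum : ∀ i j : Fin (n + 1), ∑ x, (Pi.single (Fin.last n) 2 - Pi.single i 1 -
      Pi.single j 1 : Fin (n + 1) → ℤ) x = 0 := by
    intro i j
    simp [Finset.sum_sub_distrib, Finset.sum_pi_single']
  simp only [hsum, dvd_zero, if_true, dvd_refl, taylorSer_single_two]
  have hdouble : ∑ i, ∑ j, (Λ.B (b i) (b j) : ℂ) • dTau (fun τ => taylorSer b φ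
      (Pi.single (Fin.last n) 2 - Pi.single i 1 - Pi.single j 1) τ) τ =
      (Λ.B (b (Fin.last n)) (b (Fin.last n)) : ℂ) • dTau (fun τ => φ (τ, 0)) τ := by
    rw [Finset.sum_eq_single (Fin.last n), Finset.sum_eq_single (Fin.last n), hval]
    · intro j _ hj
      rw [key _ _ (by simpa using hj)]
      exact (congrArg _ hd0).trans (smul_zero _)
    · simp
    · intro i _ hi
      refine Finset.sum_eq_zero fun j _ => ?_
      rw [key _ _ (by simp [hi])]
      exact (congrArg _ hd0).trans (smul_zero _)
    · simp
  rw [hdouble, smul_smul, smul_smul]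
  congr 2
  push_cast
  ring

end Operators

/-! ### Derivatives at `z = 0` and the slash operator. -/

section Slash

variable {V : Type*} [AddCommGroup V] [Module ℝ V]
variable {W : Type*} [NormedAddCommGroup W] [NormedSpace ℂ W]

theorem BC_tmul (Λ : IntegralLattice V) (x y : ℂ) (v w : V) :
    Λ.BC (x ⊗ₜ[ℝ] v) (y ⊗ₜ[ℝ] w) = x * y * Λ.B v w := by
  simp [IntegralLattice.BC, LinearMap.BilinForm.baseChange_tmul, mul_comm]

/-- The function `φ` is the sum of the absolutely convergent series with coefficients `c`. -/
def HasJSum (Λ : IntegralLattice V) (c : ℚ × V → W) (φ : ℍ × (ℂ ⊗[ℝ] V) → W) : Prop :=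
  ∀ (τ : ℍ) (z : ℂ ⊗[ℝ] V), HasSum
    (fun p : ℚ × V => expo (p.1 * τ + Λ.BC ((1 : ℂ) ⊗ₜ[ℝ] p.2) z) • c p) (φ (τ, z))

variable {Λ : IntegralLattice V} {c : ℚ × V → W} {φ : ℍ × (ℂ ⊗[ℝ] V) → W}

/-- Restriction to the line `z + s e` turns the double series into an exponential sum in the two
scalar variables `x` and `s`. -/
theorem HasJSum.term_eq (e : V) (c : ℚ × V → W) (x s : ℂ) (z : ℂ ⊗[ℝ] V) (p : ℚ × V) :
    expo (p.1 * x + Λ.BC ((1 : ℂ) ⊗ₜ[ℝ] p.2) (z + s ⊗ₜ[ℝ] e)) • c p =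
      expo (((p.1 : ℝ) : ℂ) * x + s * (Λ.B p.2 e : ℝ)) •
        expo (Λ.BC ((1 : ℂ) ⊗ₜ[ℝ] p.2) z) • c p := by
  rw [smul_smul, ← expo_add, map_add, BC_tmul]
  congr 2
  push_cast
  ring

/-- In finite dimension unconditional convergence is absolute. Evaluating at `τ = i y` with
displacement `-i s e` makes the norms of the terms exactly those required. -/
theorem HasJSum.expSummable [FiniteDimensional ℂ W] (h : HasJSum Λ c φ) (e : V)
    (z : ℂ ⊗[ℝ] V) :
    ExpSummable (fun p : ℚ × V => (p.1 : ℝ)) (fun p => Λ.B p.2 e)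
      (fun p => expo (Λ.BC ((1 : ℂ) ⊗ₜ[ℝ] p.2) z) • c p) := by
  intro y hy s
  have h1 := (h ⟨y * Complex.I, by simpa using hy⟩ (z + (-(s * Complex.I)) ⊗ₜ[ℝ] e)).summable
  have : FiniteDimensional ℝ W := FiniteDimensional.complexToReal W
  refine h1.norm.congr fun p => ?_
  rw [HasJSum.term_eq, norm_smul, norm_expo_term]
  simp

theorem HasJSum.eq_expSum [FiniteDimensional ℂ W] (h : HasJSum Λ c φ) (e : V) (z : ℂ ⊗[ℝ] V)
    (τ : ℍ) (s : ℂ) :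
    φ (τ, z + s ⊗ₜ[ℝ] e) = expSum (fun p : ℚ × V => (p.1 : ℝ)) (fun p => Λ.B p.2 e)
      (fun p => expo (Λ.BC ((1 : ℂ) ⊗ₜ[ℝ] p.2) z) • c p) τ s := by
  rw [← (h τ (z + s ⊗ₜ[ℝ] e)).tsum_eq]
  exact tsum_congr fun p => HasJSum.term_eq e c τ s z p

theorem HasJSum.expSummable_zero [FiniteDimensional ℂ W] (h : HasJSum Λ c φ) (e : V) :
    ExpSummable (fun p : ℚ × V => (p.1 : ℝ)) (fun p => Λ.B p.2 e) c := by
  simpa [expo_zero] using h.expSummable e 0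

theorem HasJSum.eq_expSum_zero [FiniteDimensional ℂ W] (h : HasJSum Λ c φ) (e : V)
    (τ : ℍ) (s : ℂ) :
    φ (τ, s ⊗ₜ[ℝ] e) = expSum (fun p : ℚ × V => (p.1 : ℝ)) (fun p => Λ.B p.2 e) c τ s := by
  simpa [expo_zero] using h.eq_expSum e 0 τ s

/-- The coefficients of the derivative in direction `e`. -/
def jetCoeff (Λ : IntegralLattice V) (e : V) (c : ℚ × V → W) : ℚ × V → W :=
  fun p => (2 * Real.pi * Complex.I * (Λ.B p.2 e : ℝ) : ℂ) • c p

/-- The coefficients of the derivative in the variable of the upper half plane. -/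
def tauCoeff (c : ℚ × V → W) : ℚ × V → W :=
  fun p => (2 * Real.pi * Complex.I * (p.1 : ℝ) : ℂ) • c p

theorem HasJSum.hasDerivAt_snd [FiniteDimensional ℂ W] (h : HasJSum Λ c φ) (e : V) (τ : ℍ)
    (s : ℂ) : HasDerivAt (fun s : ℂ => φ (τ, s ⊗ₜ[ℝ] e))
      (expSum (fun p : ℚ × V => (p.1 : ℝ)) (fun p => Λ.B p.2 e) (jetCoeff Λ e c) τ s) s := by
  have : CompleteSpace W := FiniteDimensional.complete ℂ W
  simp only [h.eq_expSum_zero e τ]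
  exact (h.expSummable_zero e).hasDerivAt_snd τ.im_pos s

theorem HasJSum.hasDerivAt_snd_snd [FiniteDimensional ℂ W] (h : HasJSum Λ c φ) (e : V) (τ : ℍ)
    (s : ℂ) : HasDerivAt
      (fun s : ℂ => expSum (fun p : ℚ × V => (p.1 : ℝ)) (fun p => Λ.B p.2 e)
        (jetCoeff Λ e c) τ s)
      (expSum (fun p : ℚ × V => (p.1 : ℝ)) (fun p => Λ.B p.2 e)
        (jetCoeff Λ e (jetCoeff Λ e c)) τ s) s := by
  have : CompleteSpace W := FiniteDimensional.complete ℂ W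
  exact ((h.expSummable_zero e).smul_snd _).hasDerivAt_snd τ.im_pos s

theorem eventually_im_pos {x : ℂ} (hx : 0 < x.im) : ∀ᶠ w : ℂ in nhds x, 0 < w.im :=
  (isOpen_lt continuous_const Complex.continuous_im).mem_nhds hx

theorem coe_ofComplex {x : ℂ} (hx : 0 < x.im) : (UpperHalfPlane.ofComplex x : ℂ) = x := by
  rw [UpperHalfPlane.ofComplex_apply_of_im_pos hx]

theorem HasJSum.hasDerivAt_fst [FiniteDimensional ℂ W] (h : HasJSum Λ c φ) (e : V) (τ : ℍ) :
    HasDerivAt (fun x : ℂ => φ (UpperHalfPlane.ofComplex x, 0))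
      (expSum (fun p : ℚ × V => (p.1 : ℝ)) (fun p => Λ.B p.2 e) (tauCoeff c) τ 0) τ := by
  have : CompleteSpace W := FiniteDimensional.complete ℂ W
  refine ((h.expSummable_zero e).hasDerivAt_fst τ.im_pos 0).congr_of_eventuallyEq ?_
  filter_upwards [eventually_im_pos τ.im_pos] with x hx
  have := h.eq_expSum_zero e (UpperHalfPlane.ofComplex x) 0
  rwa [TensorProduct.zero_tmul, coe_ofComplex hx] at this

theorem HasJSum.dTau_eq [FiniteDimensional ℂ W] (h : HasJSum Λ c φ) (e : V) (τ : ℍ) :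
    dTau (fun τ => φ (τ, 0)) τ =
      expSum (fun p : ℚ × V => (p.1 : ℝ)) (fun p => Λ.B p.2 e) (tauCoeff c) τ 0 :=
  (h.hasDerivAt_fst e τ).deriv

theorem HasJSum.deriv_snd [FiniteDimensional ℂ W] (h : HasJSum Λ c φ) (e : V) (τ : ℍ) :
    (deriv fun s : ℂ => φ (τ, s ⊗ₜ[ℝ] e)) =
      expSum (fun p : ℚ × V => (p.1 : ℝ)) (fun p => Λ.B p.2 e) (jetCoeff Λ e c) τ :=
  funext fun s => (h.hasDerivAt_snd e τ s).deriv

theorem HasJSum.deriv_deriv_snd [FiniteDimensional ℂ W] (h : HasJSum Λ c φ) (e : V) (τ : ℍ) :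
    (deriv (deriv fun s : ℂ => φ (τ, s ⊗ₜ[ℝ] e))) =
      expSum (fun p : ℚ × V => (p.1 : ℝ)) (fun p => Λ.B p.2 e)
        (jetCoeff Λ e (jetCoeff Λ e c)) τ := by
  rw [h.deriv_snd]
  exact funext fun s => (h.hasDerivAt_snd_snd e τ s).deriv

/-- This is the shape of a slashed function on a line through the origin, see `jacobiSlash_ofMp`: a
Gaussian in `s` times the rescaled original. -/
theorem hasDerivAt_gaussian_smul {f f' : ℂ → W} (hf : ∀ s, HasDerivAt f (f' s) s) (a q m s : ℂ) :
    HasDerivAt (fun s => (a * expo (-(q * s ^ 2))) • f (m * s))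
      ((a * expo (-(q * s ^ 2))) • (m • f' (m * s) -
        (4 * Real.pi * Complex.I * q * s) • f (m * s))) s := by
  have h1 : HasDerivAt (fun s : ℂ => -(q * s ^ 2)) (-(q * (2 * s))) s := by
    simpa using ((hasDerivAt_pow 2 s).const_mul q).fun_neg
  have h2 := ((hasDerivAt_expo (-(q * s ^ 2))).comp s h1).const_mul a
  have h3 : HasDerivAt (fun s : ℂ => m * s) m s := by
    simpa using (hasDerivAt_id s).const_mul m
  have h4 := (hf (m * s)).scomp s h3
  refine (h2.smul h4).congr_deriv ?_
  simp only [Function.comp_apply]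
  module

theorem deriv_deriv_gaussian_smul {f f' : ℂ → W} {f'' : W} (hf : ∀ s, HasDerivAt f (f' s) s)
    (hf' : HasDerivAt f' f'' 0) (a q m : ℂ) :
    deriv (deriv fun s => (a * expo (-(q * s ^ 2))) • f (m * s)) 0 =
      a • (m ^ 2 • f'' - (4 * Real.pi * Complex.I * q) • f 0) := by
  have h0 : (deriv fun s => (a * expo (-(q * s ^ 2))) • f (m * s)) = fun s =>
      (a * expo (-(q * s ^ 2))) • (m • f' (m * s) -
        (4 * Real.pi * Complex.I * q * s) • f (m * s)) :=
    funext fun s => (hasDerivAt_gaussian_smul hf a q m s).deriv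
  rw [h0]
  have h1 : HasDerivAt (fun s : ℂ => -(q * s ^ 2)) 0 0 := by
    simpa using ((hasDerivAt_pow 2 (0 : ℂ)).const_mul q).fun_neg
  have h2 := ((hasDerivAt_expo (-(q * 0 ^ 2))).comp 0 h1).const_mul a
  have h3 : HasDerivAt (fun s : ℂ => m * s) m 0 := by
    simpa using (hasDerivAt_id (0 : ℂ)).const_mul m
  have h5 : HasDerivAt f' f'' (m * 0) := by rwa [mul_zero]
  have h6 := (h5.scomp 0 h3).const_smul m
  have h7 : HasDerivAt (fun s : ℂ => 4 * Real.pi * Complex.I * q * s)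
      (4 * Real.pi * Complex.I * q) 0 := by
    simpa using (hasDerivAt_id (0 : ℂ)).const_mul (4 * Real.pi * Complex.I * q)
  have h8 := h7.smul ((hf (m * 0)).scomp 0 h3)
  refine (h2.smul (h6.sub h8)).deriv.trans ?_
  simp [expo_zero, smul_smul, sq]

/-- The element of the Jacobi group given by an element of the double cover. -/
def ofMp (Λ : IntegralLattice V) (g : Mp) : JacobiElt Λ := ⟨g, 0, 0, 1⟩

theorem jacobiSlash_ofMp (κ : ℤ) (g : Mp) (τ : ℍ) (s : ℂ) (e : V) :
    jacobiSlash Λ κ (ofMp Λ g) φ (τ, s ⊗ₜ[ℝ] e) =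
      ((g.rt τ) ^ (-κ) * expo (-(((g.mat 1 0 : ℤ) : ℂ) / autFactor g.mat τ * (Λ.B e e / 2)
        * s ^ 2))) • φ (g.mat • τ, ((autFactor g.mat τ)⁻¹ * s) ⊗ₜ[ℝ] e) := by
  simp only [jacobiSlash, ofMp, jacobiFactor, torsionPt, TensorProduct.tmul_zero, add_zero,
    IntegralLattice.QC, IntegralLattice.Q, BC_tmul, map_zero, Circle.coe_one, one_mul,
    TensorProduct.smul_tmul', smul_eq_mul, LinearMap.zero_apply, zero_div, Complex.ofReal_zero,
    mul_zero]
  congr 3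
  ring

theorem jacobiSlash_ofMp_zero (κ : ℤ) (g : Mp) (τ : ℍ) :
    jacobiSlash Λ κ (ofMp Λ g) φ (τ, 0) = (g.rt τ) ^ (-κ) • φ (g.mat • τ, 0) := by
  have := jacobiSlash_ofMp (Λ := Λ) (φ := φ) κ g τ 0 0
  simpa [expo_zero] using this

/-- Only continuity of the root is given. Since its square is `cτ + d`, the difference quotient
equals `c / (rt x + rt τ)`, which has a limit by continuity. -/
theorem Mp.hasDerivAt_rt (g : Mp) (τ : ℍ) :
    HasDerivAt (fun x : ℂ => g.rt (UpperHalfPlane.ofComplex x))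
      ((g.mat 1 0 : ℤ) / (2 * g.rt τ)) τ := by
  rw [hasDerivAt_iff_tendsto_slope]
  have hc : ContinuousAt (fun x : ℂ => g.rt (UpperHalfPlane.ofComplex x)) (τ : ℂ) :=
    g.cont.continuousAt.comp (UpperHalfPlane.mdifferentiableAt_ofComplex τ.im_pos).continuousAt
  have hlim : Filter.Tendsto (fun x : ℂ => ((g.mat 1 0 : ℤ) : ℂ) /
      (g.rt (UpperHalfPlane.ofComplex x) + g.rt τ)) (nhdsWithin (τ : ℂ) {(τ : ℂ)}ᶜ)
      (nhds ((g.mat 1 0 : ℤ) / (2 * g.rt τ))) := by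
    refine Filter.Tendsto.mono_left ?_ nhdsWithin_le_nhds
    refine Filter.Tendsto.div tendsto_const_nhds ?_ (mul_ne_zero two_ne_zero (g.rt_ne_zero τ))
    have := hc.tendsto.add_const (g.rt τ)
    simpa [two_mul] using this
  refine hlim.congr' ?_
  have hne : ∀ᶠ x : ℂ in nhds (τ : ℂ), g.rt (UpperHalfPlane.ofComplex x) + g.rt τ ≠ 0 := by
    refine (hc.add_const (g.rt τ)).eventually_ne ?_
    simpa [← two_mul] using g.rt_ne_zero τ
  filter_upwards [nhdsWithin_le_nhds hne, nhdsWithin_le_nhds (eventually_im_pos τ.im_pos),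
    self_mem_nhdsWithin] with x hx1 hx2 hx3
  have hx4 : x - τ ≠ 0 := sub_ne_zero.2 hx3
  have h1 := g.sq (UpperHalfPlane.ofComplex x)
  have h2 := g.sq τ
  rw [autFactor, coe_ofComplex hx2] at h1
  rw [autFactor] at h2
  rw [slope_def_field, UpperHalfPlane.ofComplex_apply, div_eq_div_iff hx1 hx4]
  linear_combination h2 - h1

theorem hasDerivAt_smul_SL (γ : SL(2, ℤ)) (τ : ℍ) :
    HasDerivAt (fun x : ℂ => ((γ • UpperHalfPlane.ofComplex x : ℍ) : ℂ))
      ((autFactor γ τ ^ 2)⁻¹) τ := by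
  have hdet : (γ : GL (Fin 2) ℝ).val.det = 1 :=
    (Matrix.SpecialLinearGroup.map (Int.castRingHom ℝ) γ).det_coe
  have h := (UpperHalfPlane.hasStrictDerivAt_smul (g := (γ : GL (Fin 2) ℝ))
    (by rw [hdet]; exact one_pos) τ).hasDerivAt
  rw [hdet] at h
  rw [autFactor_eq_denom]
  refine h.congr_deriv ?_
  rw [Complex.ofReal_one, one_div]

/-- The term with `κ c / (2 (cτ + d))` comes from differentiating the automorphy factor; it is the
defect that keeps the `τ`-derivative from being modular. -/
theorem HasJSum.hasDerivAt_slash [FiniteDimensional ℂ W] (h : HasJSum Λ c φ) (κ : ℤ) (g : Mp)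
    (τ : ℍ) :
    dTau (fun τ => jacobiSlash Λ κ (ofMp Λ g) φ (τ, 0)) τ =
      (g.rt τ) ^ (-κ) • ((autFactor g.mat τ ^ 2)⁻¹ • dTau (fun τ => φ (τ, 0)) (g.mat • τ) -
        (κ * (g.mat 1 0 : ℤ) / (2 * autFactor g.mat τ) : ℂ) • φ (g.mat • τ, 0)) := by
  have h1 := (h.hasDerivAt_fst 0 (g.mat • τ))
  rw [← h.dTau_eq 0] at h1
  have h1' : HasDerivAt (fun x : ℂ => φ (UpperHalfPlane.ofComplex x, 0))
      (dTau (fun τ => φ (τ, 0)) (g.mat • τ))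
      ((g.mat • UpperHalfPlane.ofComplex (τ : ℂ) : ℍ) : ℂ) := by
    rwa [UpperHalfPlane.ofComplex_apply]
  have h2 := h1'.scomp (τ : ℂ) (hasDerivAt_smul_SL g.mat τ)
  have h3 : HasDerivAt (fun x : ℂ => g.rt (UpperHalfPlane.ofComplex x) ^ (-κ))
      (((-κ : ℤ) : ℂ) * g.rt τ ^ (-κ - 1) * ((g.mat 1 0 : ℤ) / (2 * g.rt τ))) τ := by
    have h4 := hasDerivAt_zpow (-κ) (g.rt (UpperHalfPlane.ofComplex (τ : ℂ)))
      (Or.inl (g.rt_ne_zero _))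
    have h5 := h4.comp (τ : ℂ) (g.hasDerivAt_rt τ)
    rwa [UpperHalfPlane.ofComplex_apply] at h5
  have h6 := h3.smul h2
  simp only [Function.comp_def, UpperHalfPlane.ofComplex_apply] at h6
  have e : ((-κ : ℤ) : ℂ) * g.rt τ ^ (-κ - 1) * ((g.mat 1 0 : ℤ) / (2 * g.rt τ)) =
      -(g.rt τ ^ (-κ) * (κ * (g.mat 1 0 : ℤ) / (2 * autFactor g.mat τ))) := by
    have := g.rt_ne_zero τ
    rw [← g.sq τ, zpow_sub_one₀ this]
    push_cast
    field_simp
  rw [e, neg_smul, ← sub_eq_add_neg, mul_smul, ← smul_sub] at h6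
  rw [← h6.deriv]
  simp only [dTau, jacobiSlash_ofMp_zero]
  rfl

variable {n : ℕ} (b : Module.Basis (Fin (n + 1)) ℝ V) (κ : ℤ) (g : Mp)

theorem opD_zero_slash :
    opD Λ b κ 0 (jacobiSlash Λ κ (ofMp Λ g) φ) = modSlash κ g (opD Λ b κ 0 φ) := by
  funext τ
  rw [opD_zero, jacobiSlash_ofMp_zero, modSlash, opD_zero]

/-- The Gaussian is stationary at `0`, so the first derivative only sees the rescaling by `(cτ +
d)⁻¹ = rt⁻²`. -/
theorem HasJSum.opD_one_slash [FiniteDimensional ℂ W] (h : HasJSum Λ c φ) :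
    opD Λ b κ (Pi.single (Fin.last n) 1) (jacobiSlash Λ κ (ofMp Λ g) φ) =
      modSlash (κ + 2) g (opD Λ b κ (Pi.single (Fin.last n) 1) φ) := by
  funext τ
  rw [modSlash, opD_single_one, opD_single_one]
  simp only [jacobiSlash_ofMp]
  rw [(hasDerivAt_gaussian_smul (fun s => h.hasDerivAt_snd (b (Fin.last n)) (g.mat • τ) s)
    _ _ _ 0).deriv, h.deriv_snd]
  have hr := g.rt_ne_zero τ
  have : g.rt τ ^ (-(κ + 2)) = g.rt τ ^ (-κ) * (autFactor g.mat τ)⁻¹ := by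
    rw [neg_add, zpow_add₀ hr, zpow_neg _ 2, ← g.sq]; rfl
  rw [this]
  generalize g.rt τ ^ (-κ) = R
  simp only [ne_eq, OfNat.ofNat_ne_zero, not_false_eq_true, zero_pow, mul_zero, neg_zero, expo_zero,
    mul_one, zero_smul, sub_zero, smul_smul]

/-- The second derivative of the Gaussian contributes `-2πi κ c B(e, e) / (cτ + d)` times `φ`, and
the defect of the `τ`-derivative contributes its negative. The constants in the heat operator are
chosen for this cancellation. -/
theorem HasJSum.opD_two_slash [FiniteDimensional ℂ W] (h : HasJSum Λ c φ) :
    opD Λ b κ (Pi.single (Fin.last n) 2) (jacobiSlash Λ κ (ofMp Λ g) φ) =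
      modSlash (κ + 4) g (opD Λ b κ (Pi.single (Fin.last n) 2) φ) := by
  funext τ
  rw [modSlash, opD_single_two, opD_single_two, h.hasDerivAt_slash]
  simp only [jacobiSlash_ofMp]
  rw [deriv_deriv_gaussian_smul
    (fun s => h.hasDerivAt_snd (b (Fin.last n)) (g.mat • τ) s)
    (h.hasDerivAt_snd_snd (b (Fin.last n)) (g.mat • τ) 0), h.deriv_deriv_snd]
  have hr := g.rt_ne_zero τ
  have hJ := autFactor_ne_zero g.mat τ
  have : g.rt τ ^ (-(κ + 4)) = g.rt τ ^ (-κ) * ((autFactor g.mat τ ^ 2)⁻¹) := by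
    rw [neg_add, zpow_add₀ hr, zpow_neg _ 4, ← g.sq, ← pow_mul]; rfl
  rw [this, TensorProduct.zero_tmul]
  generalize g.rt τ ^ (-κ) = R
  generalize φ (g.mat • τ, 0) = X
  generalize expSum (fun p : ℚ × V => (p.1 : ℝ)) (fun p => Λ.B p.2 (b (Fin.last n)))
    (jetCoeff Λ (b (Fin.last n)) (jetCoeff Λ (b (Fin.last n)) c)) (g.mat • τ : ℍ) 0 = Y
  generalize dTau (fun τ => φ (τ, 0)) (g.mat • τ) = Z
  match_scalars <;> field_simp
  ring

end Slash

/-! ### The operators as linear maps into spaces of modular forms. -/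

section Embedding

variable {V : Type*} [AddCommGroup V] [Module ℝ V]
variable {W : Type*} [NormedAddCommGroup W] [NormedSpace ℂ W]
variable {Λ : IntegralLattice V} {c : ℚ × V → W} {φ : ℍ × (ℂ ⊗[ℝ] V) → W}

theorem HoloH.of_hasDerivAt {f : ℍ → W} {f' : ℍ → W}
    (h : ∀ τ : ℍ, HasDerivAt (fun x : ℂ => f (UpperHalfPlane.ofComplex x)) (f' τ) τ) :
    HoloH f := fun x hx =>
  (h ⟨x, hx⟩).differentiableAt.differentiableWithinAt

theorem ExpSummable.holoH {ι : Type*} [CompleteSpace W] {ν ξ : ι → ℝ} {d : ι → W}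
    (h : ExpSummable ν ξ d) : HoloH fun τ : ℍ => expSum ν ξ d τ 0 := by
  refine HoloH.of_hasDerivAt
    (f' := fun τ => expSum ν ξ (fun i => (2 * Real.pi * Complex.I * ν i) • d i) τ 0) fun τ => ?_
  refine (h.hasDerivAt_fst τ.im_pos 0).congr_of_eventuallyEq ?_
  filter_upwards [eventually_im_pos τ.im_pos] with x hx
  rw [coe_ofComplex hx]

theorem hasQExp_of_hasSum [CompleteSpace W] {P : ℚ → Prop} {f : ℍ → W} (d : ℚ × V → W) {N : ℕ}
    (hN : 0 < N) (hd : ∀ n t, d (n, t) ≠ 0 → (∃ m : ℤ, n * N = m) ∧ P n)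
    (hs : ∀ τ : ℍ, HasSum (fun p : ℚ × V => expo (p.1 * τ) • d p) (f τ)) : HasQExp P f := by
  refine ⟨N, fun n => ∑' t, d (n, t), hN, fun n hn => ?_, fun τ => ?_⟩
  · obtain ⟨t, ht⟩ : ∃ t, d (n, t) ≠ 0 := by
      by_contra! h
      exact hn (by simp [h])
    exact hd n t ht
  · refine (hs τ).prod_fiberwise fun n => ?_
    -- Dividing the fibre over `n` by its common nonzero factor shows that the collected coefficient
    -- is itself a convergent sum.
    have h1 := ((hs τ).summable.prod_factor n).const_smul (expo (n * τ))⁻¹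
    simp only [smul_smul, inv_mul_cancel₀ (expo_ne_zero _), one_smul] at h1
    exact h1.hasSum.const_smul (expo (n * τ))

/-- An operator from functions on `ℍ × (ℂ ⊗ V)` to functions on `ℍ` that multiplies the coefficients
of series by the weights `l` and maps the slash operator of weight `κ / 2` to that of
weight `κ' / 2`. -/
structure IsJetOp (Λ : IntegralLattice V) (κ κ' : ℤ)
    (D : (ℍ × (ℂ ⊗[ℝ] V) → W) → ℍ → W) (l : ℚ × V → ℂ) : Prop where
  hasSum : ∀ {φ : ℍ × (ℂ ⊗[ℝ] V) → W} {c : ℚ × V → W}, HasJSum Λ c φ → ∀ τ : ℍ,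
    HasSum (fun p : ℚ × V => expo (p.1 * τ) • l p • c p) (D φ τ)
  holoH : ∀ {φ : ℍ × (ℂ ⊗[ℝ] V) → W} {c : ℚ × V → W}, HasJSum Λ c φ → HoloH (D φ)
  slash : ∀ {φ : ℍ × (ℂ ⊗[ℝ] V) → W} {c : ℚ × V → W}, HasJSum Λ c φ → ∀ g : Mp,
    D (jacobiSlash Λ κ (ofMp Λ g) φ) = modSlash κ' g (D φ)

theorem ExpSummable.hasSum_zero {ξ : ℚ × V → ℝ} [CompleteSpace W] {d : ℚ × V → W}
    (h : ExpSummable (fun p => (p.1 : ℝ)) ξ d) (τ : ℍ) :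
    HasSum (fun p : ℚ × V => expo (p.1 * τ) • d p)
      (expSum (fun p : ℚ × V => (p.1 : ℝ)) ξ d τ 0) := by
  simpa using h.hasSum τ.im_pos 0

variable {n : ℕ} (b : Module.Basis (Fin (n + 1)) ℝ V) (κ : ℤ)

theorem isJetOp_zero [FiniteDimensional ℂ W] :
    IsJetOp (W := W) Λ κ κ (opD Λ b κ 0) fun _ => 1 where
  hasSum {φ c} h τ := by
    have := h τ 0
    simpa [opD_zero] using this
  holoH {φ c} h := by
    rw [funext fun τ => opD_zero Λ b κ φ τ]
    exact HoloH.of_hasDerivAt fun τ => h.hasDerivAt_fst 0 τ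
  slash _ g := opD_zero_slash b κ g

theorem isJetOp_one [FiniteDimensional ℂ W] :
    IsJetOp (W := W) Λ κ (κ + 2) (opD Λ b κ (Pi.single (Fin.last n) 1))
      fun p => 2 * Real.pi * Complex.I * (Λ.B p.2 (b (Fin.last n)) : ℝ) where
  hasSum {φ c} h τ := by
    have : CompleteSpace W := FiniteDimensional.complete ℂ W
    rw [opD_single_one, h.deriv_snd]
    exact ((h.expSummable_zero (b (Fin.last n))).smul_snd (2 * Real.pi * Complex.I)).hasSum_zero τ
  holoH {φ c} h := by
    have : CompleteSpace W := FiniteDimensional.complete ℂ W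
    have e : opD Λ b κ (Pi.single (Fin.last n) 1) φ = _ := funext fun τ =>
      (opD_single_one Λ b κ φ τ).trans (congrFun (h.deriv_snd _ _) 0)
    rw [e]
    exact ((h.expSummable_zero (b (Fin.last n))).smul_snd (2 * Real.pi * Complex.I)).holoH
  slash h g := h.opD_one_slash b κ g

theorem isJetOp_two [FiniteDimensional ℂ W] :
    IsJetOp (W := W) Λ κ (κ + 4) (opD Λ b κ (Pi.single (Fin.last n) 2))
      fun p => κ * (2 * Real.pi * Complex.I * (Λ.B p.2 (b (Fin.last n)) : ℝ)) ^ 2 -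
        4 * Real.pi * Complex.I * Λ.B (b (Fin.last n)) (b (Fin.last n)) *
          (2 * Real.pi * Complex.I * p.1) where
  hasSum {φ c} h τ := by
    have : CompleteSpace W := FiniteDimensional.complete ℂ W
    rw [opD_single_two, h.deriv_deriv_snd, h.dTau_eq (b (Fin.last n))]
    have h0 := h.expSummable_zero (b (Fin.last n))
    have h1 := (((h0.smul_snd (2 * Real.pi * Complex.I)).smul_snd
      (2 * Real.pi * Complex.I)).hasSum_zero τ).const_smul (κ : ℂ)
    have h2 := ((h0.smul_fst (2 * Real.pi * Complex.I)).hasSum_zero τ).const_smul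
      (4 * Real.pi * Complex.I * Λ.B (b (Fin.last n)) (b (Fin.last n)) : ℂ)
    refine (h1.sub h2).congr_fun ?_
    intro p
    push_cast
    module
  holoH {φ c} h := by
    have : CompleteSpace W := FiniteDimensional.complete ℂ W
    have e : opD Λ b κ (Pi.single (Fin.last n) 2) φ = _ := funext fun τ => by
      rw [opD_single_two, h.deriv_deriv_snd, h.dTau_eq (b (Fin.last n))]
    rw [e]
    have h0 := h.expSummable_zero (b (Fin.last n))
    have h1 := ((h0.smul_snd (2 * Real.pi * Complex.I)).smul_snd (2 * Real.pi * Complex.I)).holoH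
    have h2 := (h0.smul_fst (2 * Real.pi * Complex.I)).holoH
    exact (DifferentiableOn.const_smul h1 _).sub (DifferentiableOn.const_smul h2 _)
  slash h g := h.opD_two_slash b κ g

variable {b κ} {κ' : ℤ} {D : (ℍ × (ℂ ⊗[ℝ] V) → W) → ℍ → W} {l : ℚ × V → ℂ}

theorem HasJSum.add {c' : ℚ × V → W} {φ' : ℍ × (ℂ ⊗[ℝ] V) → W} (h : HasJSum Λ c φ)
    (h' : HasJSum Λ c' φ') : HasJSum Λ (c + c') (φ + φ') := fun τ z => by
  simpa [smul_add] using (h τ z).add (h' τ z)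

theorem HasJSum.const_smul (h : HasJSum Λ c φ) (a : ℂ) : HasJSum Λ (a • c) (a • φ) := fun τ z => by
  simpa only [Pi.smul_apply, smul_comm a] using (h τ z).const_smul a

theorem HasJSum.map (h : HasJSum Λ c φ) (A : W →L[ℂ] W) :
    HasJSum Λ (fun p => A (c p)) (fun x => A (φ x)) := fun τ z => by
  simpa using A.hasSum (h τ z)

namespace IsJetOp

/-- Nothing is known about `D` on arbitrary functions, where derivatives may take default values. On
sums of series it acts coefficientwise, and uniqueness of sums gives additivity. -/
theorem map_add (hD : IsJetOp Λ κ κ' D l) {c' : ℚ × V → W} {φ' : ℍ × (ℂ ⊗[ℝ] V) → W}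
    (h : HasJSum Λ c φ) (h' : HasJSum Λ c' φ') : D (φ + φ') = D φ + D φ' := funext fun τ =>
  (hD.hasSum (h.add h') τ).unique (by
    simpa [smul_add] using (hD.hasSum h τ).add (hD.hasSum h' τ))

theorem map_smul (hD : IsJetOp Λ κ κ' D l) (h : HasJSum Λ c φ) (a : ℂ) :
    D (a • φ) = a • D φ := funext fun τ =>
  (hD.hasSum (h.const_smul a) τ).unique (by
    simpa only [Pi.smul_apply, smul_comm a] using (hD.hasSum h τ).const_smul a)

theorem map_clm (hD : IsJetOp Λ κ κ' D l) (h : HasJSum Λ c φ) (A : W →L[ℂ] W) :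
    D (fun x => A (φ x)) = fun τ => A (D φ τ) := funext fun τ =>
  (hD.hasSum (h.map A) τ).unique (by simpa using A.hasSum (hD.hasSum h τ))

/-- Pairs whose weight `l` is zero drop out of the support, which is how cuspidality can arise from
a weaker condition `P`. -/
theorem hasQExp [CompleteSpace W] (hD : IsJetOp Λ κ κ' D l) {P : ℚ → V → Prop} {P' : ℚ → Prop}
    (hP : ∀ n t, P n t → l (n, t) ≠ 0 → P' n) (h : HasJExp Λ P φ) : HasQExp P' (D φ) := by
  obtain ⟨N, c, hN, hc, hs⟩ := h
  refine hasQExp_of_hasSum (fun p => l p • c p) hN (fun n t hnt => ?_) (hD.hasSum hs)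
  obtain ⟨h1, h2⟩ := smul_ne_zero_iff.1 hnt
  obtain ⟨h3, -, h4⟩ := hc n t h2
  exact ⟨h3, hP n t h4 h1⟩

/-- In finite dimension `ρ g` is continuous, so it passes through the infinite sums and commutes
with `D`. -/
theorem mem_modFormHol [FiniteDimensional ℂ W] (hD : IsJetOp Λ κ κ' D l)
    {G : Subgroup SL(2, ℤ)} {ρ : Representation ℂ (jacobiGroup Λ G) W}
    (hφ : φ ∈ jacobiFormHol Λ κ G ρ) (h : HasJSum Λ c φ) :
    D φ ∈ modFormHol κ' G (ρ.comp (mpEmbed Λ G)) := by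
  refine ⟨hD.holoH h, fun g τ => ?_⟩
  rw [← hD.slash h]
  have e : jacobiSlash Λ κ (ofMp Λ g) φ =
      fun x => (LinearMap.toContinuousLinearMap (ρ (mpEmbed Λ G g))) (φ x) :=
    funext fun x => hφ.2 (mpEmbed Λ G g) x
  rw [e, hD.map_clm h]
  rfl

theorem modSlash_hasQExp [CompleteSpace W] (hD : IsJetOp Λ κ κ' D l) {P : ℚ → V → Prop}
    {P' : ℚ → Prop} (hP : ∀ n t, P n t → l (n, t) ≠ 0 → P' n) (h : HasJSum Λ c φ) {g : Mp}
    (hg : HasJExp Λ P (jacobiSlash Λ κ (ofMp Λ g) φ)) : HasQExp P' (modSlash κ' g (D φ)) := by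
  rw [← hD.slash h]
  exact hD.hasQExp hP hg

end IsJetOp

theorem ofMp_mem (g : Mp) : ofMp Λ g ∈ jacobiGroup Λ ⊤ :=
  ⟨Subgroup.mem_top _, Λ.L.zero_mem, Λ.L.zero_mem, one_pow 2⟩

theorem jacobiSlash_one : jacobiSlash Λ κ 1 φ = φ := by
  funext x
  simp [jacobiSlash, jacobiFactor, autFactor, torsionPt, IntegralLattice.Q, expo_zero]

theorem HasJExp.exists_hasJSum {P : ℚ → V → Prop} (h : HasJExp Λ P φ) : ∃ c, HasJSum Λ c φ := by
  obtain ⟨N, c, -, -, hs⟩ := h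
  exact ⟨c, hs⟩

variable {G : Subgroup SL(2, ℤ)} {ρ : Representation ℂ (jacobiGroup Λ G) W}

theorem exists_hasJSum_of_mem_wHol (hφ : φ ∈ jacobiFormWHol Λ κ G ρ) : ∃ c, HasJSum Λ c φ := by
  obtain ⟨n₀, h⟩ := hφ.2 1 (one_mem _)
  rw [jacobiSlash_one] at h
  exact h.exists_hasJSum

theorem exists_hasJSum_of_mem {P : ℚ → V → Prop} (hφ : φ ∈ jacobiFormOf Λ P κ G ρ) :
    ∃ c, HasJSum Λ c φ := by
  have h := hφ.2 1 (one_mem _)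
  rw [jacobiSlash_one] at h
  exact h.exists_hasJSum

namespace IsJetOp

variable [FiniteDimensional ℂ W]

theorem mem_modFormWHol (hD : IsJetOp Λ κ κ' D l) (hφ : φ ∈ jacobiFormWHol Λ κ G ρ) :
    D φ ∈ modFormWHol κ' G (ρ.comp (mpEmbed Λ G)) := by
  have : CompleteSpace W := FiniteDimensional.complete ℂ W
  obtain ⟨c, h⟩ := exists_hasJSum_of_mem_wHol hφ
  refine ⟨hD.mem_modFormHol hφ.1 h, fun g => ?_⟩
  obtain ⟨n₀, hn⟩ := hφ.2 _ (ofMp_mem g)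
  exact ⟨n₀, hD.modSlash_hasQExp (P' := fun n => n₀ ≤ n) (fun _ _ h _ => h) h hn⟩

theorem mem_modFormOf (hD : IsJetOp Λ κ κ' D l) {P : ℚ → V → Prop} {P' : ℚ → Prop}
    (hP : ∀ n t, P n t → l (n, t) ≠ 0 → P' n) (hφ : φ ∈ jacobiFormOf Λ P κ G ρ) :
    D φ ∈ modFormOf P' κ' G (ρ.comp (mpEmbed Λ G)) := by
  have : CompleteSpace W := FiniteDimensional.complete ℂ W
  obtain ⟨c, h⟩ := exists_hasJSum_of_mem hφ
  exact ⟨hD.mem_modFormHol hφ.1 h, fun g => hD.modSlash_hasQExp hP h (hφ.2 _ (ofMp_mem g))⟩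

/-- The linear map defined by a jet operator. -/
def toLin (hD : IsJetOp Λ κ κ' D l) {S : Submodule ℂ (ℍ × (ℂ ⊗[ℝ] V) → W)}
    {M : Submodule ℂ (ℍ → W)} (hS : ∀ φ ∈ S, ∃ c, HasJSum Λ c φ) (hM : ∀ φ ∈ S, D φ ∈ M) :
    S →ₗ[ℂ] M where
  toFun φ := ⟨D φ, hM φ φ.2⟩
  map_add' φ φ' := by
    obtain ⟨c, h⟩ := hS φ φ.2
    obtain ⟨c', h'⟩ := hS φ' φ'.2
    exact Subtype.ext (hD.map_add h h')
  map_smul' a φ := by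
    obtain ⟨c, h⟩ := hS φ φ.2
    exact Subtype.ext (hD.map_smul h a)

end IsJetOp

theorem IntegralLattice.Q_nonneg (Λ : IntegralLattice V) (t : V) : 0 ≤ Λ.Q t := by
  by_cases h : t = 0
  · simp [h, IntegralLattice.Q]
  · exact (half_pos (Λ.posDef t h)).le

theorem IntegralLattice.Q_pos (Λ : IntegralLattice V) {t : V} (h : t ≠ 0) : 0 < Λ.Q t :=
  half_pos (Λ.posDef t h)

theorem nonneg_of_Q_le {m : ℚ} {t : V} (h : 0 ≤ (m : ℝ) - Λ.Q t) : 0 ≤ m := by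
  have : (0 : ℝ) ≤ m := by linarith [Λ.Q_nonneg t]
  exact_mod_cast this

theorem pos_of_Q_le {m : ℚ} {t : V} (h : 0 ≤ (m : ℝ) - Λ.Q t) (hmt : m ≠ 0 ∨ t ≠ 0) : 0 < m := by
  rcases hmt with hm | ht
  · exact lt_of_le_of_ne (nonneg_of_Q_le h) (Ne.symm hm)
  · have : (0 : ℝ) < m := by linarith [Λ.Q_pos ht]
    exact_mod_cast this

end Embedding

/-! ### Uniqueness of Fourier coefficients and the elliptic transformation law. -/

section Fourier

variable {V : Type*} [AddCommGroup V] [Module ℝ V]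
variable {W : Type*} [NormedAddCommGroup W] [NormedSpace ℂ W]
variable {Λ : IntegralLattice V}

theorem norm_expo_ofReal (x : ℝ) : ‖expo x‖ = 1 := by simp [norm_expo]

theorem expo_eq_one_iff (x : ℝ) : expo x = 1 ↔ ∃ n : ℤ, x = n := by
  rw [expo, Complex.exp_eq_one_iff]
  refine exists_congr fun n => ?_
  have : (2 * Real.pi * Complex.I : ℂ) ≠ 0 := by simp [Real.pi_ne_zero]
  constructor
  · intro h
    have h' : (2 * Real.pi * Complex.I : ℂ) * (x : ℂ) = (2 * Real.pi * Complex.I) * (n : ℂ) := by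
      rw [h]; ring
    exact_mod_cast mul_left_cancel₀ this h'
  · rintro rfl
    push_cast; ring

theorem expo_half : expo ((1 / 2 : ℝ) : ℂ) = -1 := by
  rw [expo, ← Complex.exp_pi_mul_I]
  congr 1
  push_cast
  ring

/-- The product of the factors `(1 + e(B(t - t₀, u))) / 2` over a finite set of vectors `u`. -/
def cutoff (Λ : IntegralLattice V) (t₀ : V) (F : Finset V) (t : V) : ℂ :=
  ∏ u ∈ F, (1 + expo (Λ.B (t - t₀) u)) / 2

theorem norm_cutoff_le (t₀ : V) (F : Finset V) (t : V) : ‖cutoff Λ t₀ F t‖ ≤ 1 := by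
  rw [cutoff, norm_prod]
  refine Finset.prod_le_one (fun _ _ => norm_nonneg _) fun u _ => ?_
  rw [norm_div, Complex.norm_ofNat, div_le_one two_pos]
  refine (norm_add_le _ _).trans ?_
  rw [norm_one, norm_expo_ofReal]
  norm_num

theorem cutoff_self (t₀ : V) (F : Finset V) : cutoff Λ t₀ F t₀ = 1 := by
  simp [cutoff, expo_zero]

theorem exists_cutoff_eq_zero {t₀ t : V} (h : t ≠ t₀) :
    ∃ u, ∀ F : Finset V, u ∈ F → cutoff Λ t₀ F t = 0 := by
  have h0 := Λ.posDef _ (sub_ne_zero.2 h)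
  -- The vector is scaled so that its pairing with `t - t₀` is `1/2`; its factor is then `(1 +
  -- e(1/2)) / 2 = 0`.
  refine ⟨(1 / (2 * Λ.B (t - t₀) (t - t₀))) • (t - t₀), fun F hF => ?_⟩
  refine Finset.prod_eq_zero hF ?_
  have : Λ.B (t - t₀) ((1 / (2 * Λ.B (t - t₀) (t - t₀))) • (t - t₀)) = 1 / 2 := by
    rw [map_smul, smul_eq_mul]; field_simp
  rw [this, expo_half]
  norm_num

theorem summable_cutoff [CompleteSpace W] {C : V → W} (hC : Summable fun t => ‖C t‖) (t₀ : V)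
    (F : Finset V) (x : V) :
    Summable fun t => expo (Λ.B t x) • cutoff Λ t₀ F t • C t := by
  refine Summable.of_norm_bounded hC fun t => ?_
  rw [norm_smul, norm_smul, norm_expo_ofReal, one_mul]
  exact mul_le_of_le_one_left (norm_nonneg _) (norm_cutoff_le _ _ _)

/-- Multiplying coefficients by `(1 + e(B(t - t₀, u))) / 2` amounts to averaging the sum at `x` with
its twisted translate at `x + u`, and both vanish. -/
theorem tsum_cutoff_eq_zero [CompleteSpace W] {C : V → W} (hC : Summable fun t => ‖C t‖)
    (h : ∀ x : V, ∑' t, expo (Λ.B t x) • C t = 0) (t₀ : V) (F : Finset V) (x : V) :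
    ∑' t, expo (Λ.B t x) • cutoff Λ t₀ F t • C t = 0 := by
  classical
  induction F using Finset.induction_on generalizing x with
  | empty => simpa [cutoff] using h x
  | insert u F hu ih =>
    have h1 := (summable_cutoff (Λ := Λ) hC t₀ F x).hasSum
    have h2 := (summable_cutoff (Λ := Λ) hC t₀ F (x + u)).hasSum
    rw [ih] at h1 h2
    have h3 := (h1.const_smul (1 / 2 : ℂ)).add
      (h2.const_smul (expo (-(Λ.B t₀ u : ℂ)) / 2))
    rw [smul_zero, smul_zero, add_zero] at h3
    rw [← h3.tsum_eq]
    refine tsum_congr fun t => ?_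
    simp only [cutoff, Finset.prod_insert hu, smul_smul, ← add_smul]
    congr 1
    have : expo (Λ.B (t - t₀) u) = expo (Λ.B t u) * expo (-(Λ.B t₀ u : ℂ)) := by
      rw [← expo_add]; congr 1; simp; ring
    rw [this, map_add]
    push_cast
    rw [expo_add]
    ring

/-- The coefficients of an absolutely convergent trigonometric series are determined by its sum. -/
theorem fourier_unique [CompleteSpace W] {C : V → W} (hC : Summable fun t => ‖C t‖)
    (h : ∀ x : V, ∑' t, expo (Λ.B t x) • C t = 0) (t₀ : V) : C t₀ = 0 := by
  classical
  -- As the finite set `F` grows, the cutoffs stay bounded by `1` and converge pointwise to the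
  -- indicator of `t₀`. Dominated convergence isolates the coefficient, with no discreteness of the
  -- frequencies required.
  have h1 : Filter.Tendsto (fun F : Finset V => ∑' t, cutoff Λ t₀ F t • C t) Filter.atTop
      (nhds (∑' t, if t = t₀ then C t₀ else 0)) := by
    refine tendsto_tsum_of_dominated_convergence hC (fun t => ?_)
      (Filter.Eventually.of_forall fun F t => ?_)
    · by_cases ht : t = t₀
      · subst ht
        simp [cutoff_self]
      · obtain ⟨u, hu⟩ := exists_cutoff_eq_zero (Λ := Λ) ht
        rw [if_neg ht]
        refine tendsto_const_nhds.congr' ?_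
        filter_upwards [Filter.eventually_ge_atTop {u}] with F hF
        rw [hu F (hF (Finset.mem_singleton_self u)), zero_smul]
    · rw [norm_smul]
      exact mul_le_of_le_one_left (norm_nonneg _) (norm_cutoff_le _ _ _)
  rw [tsum_ite_eq] at h1
  have h2 : ∀ F : Finset V, ∑' t, cutoff Λ t₀ F t • C t = 0 := fun F => by
    simpa [expo_zero] using tsum_cutoff_eq_zero hC h t₀ F 0
  simp only [h2] at h1
  exact tendsto_nhds_unique h1 tendsto_const_nhds

theorem fourier_unique_of_hasSum [FiniteDimensional ℂ W] {C : V → W}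
    (h : ∀ x : V, HasSum (fun t => expo (Λ.B t x) • C t) 0) (t : V) : C t = 0 := by
  have : CompleteSpace W := FiniteDimensional.complete ℂ W
  have : FiniteDimensional ℝ W := FiniteDimensional.complexToReal W
  refine fourier_unique (Λ := Λ) ?_ (fun x => (h x).tsum_eq) t
  have := (h 0).summable.norm
  simpa [expo_zero] using this

variable {G : Subgroup SL(2, ℤ)} {ρ : Representation ℂ (jacobiGroup Λ G) W} {κ : ℤ}
  {φ : ℍ × (ℂ ⊗[ℝ] V) → W} {c : ℚ × V → W}

theorem jacobiForm_add_lattice (hw : ∀ v : Λ.L, ρ (heis Λ G 0 v 1 (one_pow 2)) = 1)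
    (hφ : φ ∈ jacobiFormHol Λ κ G ρ) (τ : ℍ) (z : ℂ ⊗[ℝ] V) (w : Λ.L) :
    φ (τ, z + (1 : ℂ) ⊗ₜ[ℝ] (w : V)) = φ (τ, z) := by
  have h := hφ.2 (heis Λ G 0 w 1 (one_pow 2)) (τ, z)
  rw [hw] at h
  simpa [heis, jacobiSlash, jacobiFactor, autFactor, torsionPt, IntegralLattice.Q,
    expo_zero] using h

theorem jacobiForm_add_tau_lattice (hv : ∀ v : Λ.L, ρ (heis Λ G v 0 1 (one_pow 2)) = 1)
    (hφ : φ ∈ jacobiFormHol Λ κ G ρ) (τ : ℍ) (z : ℂ ⊗[ℝ] V) (v : Λ.L) :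
    expo (τ * Λ.Q v + Λ.BC ((1 : ℂ) ⊗ₜ[ℝ] (v : V)) z) •
      φ (τ, z + (τ : ℂ) ⊗ₜ[ℝ] (v : V)) = φ (τ, z) := by
  have h := hφ.2 (heis Λ G v 0 1 (one_pow 2)) (τ, z)
  rw [hv] at h
  simpa [heis, jacobiSlash, jacobiFactor, autFactor, torsionPt] using h

/-- The Fourier coefficients of `φ (τ, ·)`, for a series with coefficients `c`. -/
def fiberCoeff (c : ℚ × V → W) (τ : ℍ) (t : V) : W := ∑' m : ℚ, expo (m * τ) • c (m, t)

/-- The weight depends on `t` alone, so summing over the exponents of `q` first leaves it outside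
the inner sum. -/
theorem hasSum_fiberCoeff [CompleteSpace W] (h : HasJSum Λ c φ) {τ : ℍ} {l : V → ℂ} {f : W}
    (hs : HasSum (fun p : ℚ × V => expo (p.1 * τ) • l p.2 • c p) f) :
    HasSum (fun t => l t • fiberCoeff c τ t) f := by
  have h0 : ∀ t, HasSum (fun m : ℚ => expo (m * τ) • c (m, t)) (fiberCoeff c τ t) := fun t => by
    have := (((Equiv.prodComm V ℚ).hasSum_iff.2 (h τ 0)).summable.prod_factor t).hasSum
    simpa [fiberCoeff] using this
  refine ((Equiv.prodComm V ℚ).hasSum_iff.2 hs).prod_fiberwise fun t => ?_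
  refine ((h0 t).const_smul (l t)).congr_fun fun m => ?_
  simp only [Function.comp_apply, Equiv.prodComm_apply, Prod.swap_prod_mk]
  rw [smul_comm]

theorem HasJSum.hasSum_fiberCoeff [CompleteSpace W] (h : HasJSum Λ c φ) (τ : ℍ)
    (z : ℂ ⊗[ℝ] V) :
    HasSum (fun t => expo (Λ.BC ((1 : ℂ) ⊗ₜ[ℝ] t) z) • fiberCoeff c τ t) (φ (τ, z)) := by
  refine JacobiTaylor.hasSum_fiberCoeff h ((h τ z).congr_fun fun p => ?_)
  rw [expo_add, mul_smul]

/-- Comparing coefficients in `φ(τ, z + w) = φ(τ, z)` gives `(e(B(t, w)) - 1) C(t) = 0`, so `B(t,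
w)` is an integer wherever `C(t) ≠ 0`. -/
theorem fiberCoeff_mem_dual [FiniteDimensional ℂ W]
    (hw : ∀ v : Λ.L, ρ (heis Λ G 0 v 1 (one_pow 2)) = 1)
    (hφ : φ ∈ jacobiFormHol Λ κ G ρ) (h : HasJSum Λ c φ) (τ : ℍ) {t : V}
    (ht : fiberCoeff c τ t ≠ 0) : t ∈ Λ.dual := by
  have : CompleteSpace W := FiniteDimensional.complete ℂ W
  intro w hwL
  rw [← expo_eq_one_iff, ← sub_eq_zero]
  have key : (expo (Λ.B t w) - 1) • fiberCoeff c τ t = 0 := by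
    refine fourier_unique_of_hasSum (Λ := Λ)
      (C := fun t => (expo (Λ.B t w) - 1) • fiberCoeff c τ t) (fun x => ?_) t
    have h1 := h.hasSum_fiberCoeff τ ((1 : ℂ) ⊗ₜ[ℝ] x)
    have h2 := h.hasSum_fiberCoeff τ ((1 : ℂ) ⊗ₜ[ℝ] x + (1 : ℂ) ⊗ₜ[ℝ] w)
    rw [jacobiForm_add_lattice hw hφ τ _ ⟨w, hwL⟩] at h2
    have h3 := h2.sub h1
    rw [sub_self] at h3
    refine h3.congr_fun fun t => ?_
    rw [map_add, BC_tmul, BC_tmul, expo_add]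
    simp only [one_mul]
    module
  exact (smul_eq_zero.1 key).resolve_right ht

/-- Comparing coefficients in the transformation law for `z ↦ z + τ v`. Equivalently, `C(t) e(-τ
Q(t))` is constant on cosets of the lattice. -/
theorem fiberCoeff_add [FiniteDimensional ℂ W]
    (hv : ∀ v : Λ.L, ρ (heis Λ G v 0 1 (one_pow 2)) = 1)
    (hφ : φ ∈ jacobiFormHol Λ κ G ρ) (h : HasJSum Λ c φ) (τ : ℍ) (t : V) (v : Λ.L) :
    fiberCoeff c τ (t + v) = expo (τ * (Λ.Q v + Λ.B t v)) • fiberCoeff c τ t := by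
  have : CompleteSpace W := FiniteDimensional.complete ℂ W
  rw [← sub_eq_zero]
  refine fourier_unique_of_hasSum (Λ := Λ) (C := fun t => fiberCoeff c τ (t + v) -
    expo (τ * (Λ.Q v + Λ.B t v)) • fiberCoeff c τ t) (fun x => ?_) t
  -- The factor `e(-B(v, x))` compensates for the reindexing `t ↦ t + v`, so that `C(t + v)` appears
  -- with frequency `t`.
  have h1 := (h.hasSum_fiberCoeff τ ((1 : ℂ) ⊗ₜ[ℝ] x)).const_smul (expo (-(Λ.B v x : ℂ)))
  have h1' := (Equiv.addRight (v : V)).hasSum_iff.2 h1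
  have h2 := (h.hasSum_fiberCoeff τ ((1 : ℂ) ⊗ₜ[ℝ] x + (τ : ℂ) ⊗ₜ[ℝ] (v : V))).const_smul
    (expo (τ * Λ.Q v))
  have e := jacobiForm_add_tau_lattice hv hφ τ ((1 : ℂ) ⊗ₜ[ℝ] x) v
  rw [← e, BC_tmul, expo_add, smul_smul] at h1'
  have e2 : expo (-(Λ.B v x : ℂ)) * (expo (τ * Λ.Q v) * expo (1 * 1 * (Λ.B v x : ℂ))) =
      expo (τ * Λ.Q v) := by
    rw [← expo_add, ← expo_add]; congr 1; ring
  rw [e2] at h1'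
  have h3 := h1'.sub h2
  rw [sub_self] at h3
  refine h3.congr_fun fun t => ?_
  simp only [Function.comp_apply, Equiv.coe_addRight, map_add, BC_tmul, smul_sub, smul_smul,
    ← expo_add]
  congr 3
  · simp
  · ring

end Fourier

/-! ### Theta series with powers of a linear form, and their determinant. -/

section Theta

theorem summable_exp_neg_norm_sq {E : Type*} [NormedAddCommGroup E] [NormedSpace ℝ E]
    [FiniteDimensional ℝ E] (L : Submodule ℤ E) [DiscreteTopology L] (x : E) {y : ℝ}
    (hy : 0 < y) : Summable fun z : L => Real.exp (-(y * ‖(z : E) - x‖ ^ 2)) := by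
  -- The Gaussian is compared with `r^{-2k}`; this `k` makes `2k` exceed the rank, as lattice sums
  -- of inverse powers require.
  set k := Module.finrank ℤ L + 1 with hk
  have h1 := (ZLattice.summable_norm_sub_inv_pow (L := L) (2 * k) (by omega) x).mul_left
    ((k.factorial : ℝ) / y ^ k)
  refine Summable.of_norm_bounded_eventually h1 ?_
  -- At `z = x` the comparison fails, because the inverse power there is `0` by convention while the
  -- exponential is `1`. At most one point has to be discarded.
  have hfin : {z : L | (z : E) = x}.Finite :=
    Set.Subsingleton.finite fun a ha b hb => Subtype.ext (ha.trans hb.symm)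
  refine hfin.subset fun z hz => ?_
  by_contra hzx
  refine hz ?_
  change ‖Real.exp (-(y * ‖(z : E) - x‖ ^ 2))‖ ≤ _
  have hr : 0 < ‖(z : E) - x‖ := norm_pos_iff.2 (sub_ne_zero.2 hzx)
  have h2 := Real.pow_div_factorial_le_exp (y * ‖(z : E) - x‖ ^ 2) (by positivity) k
  rw [Real.norm_eq_abs, abs_of_pos (Real.exp_pos _), Real.exp_neg]
  calc (Real.exp (y * ‖(z : E) - x‖ ^ 2))⁻¹
      ≤ ((y * ‖(z : E) - x‖ ^ 2) ^ k / k.factorial)⁻¹ := by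
        refine inv_anti₀ (by positivity) h2
    _ = _ := by rw [mul_pow, ← pow_mul, inv_div, inv_pow]; field_simp

variable {V : Type*} [AddCommGroup V] [Module ℝ V] (Λ : IntegralLattice V)

/-- The inner product on `V` given by `B`. -/
@[reducible] def IntegralLattice.innerCore : InnerProductSpace.Core ℝ V where
  inner x y := Λ.B x y
  conj_inner_symm x y := by simp [Λ.symm y x]
  re_inner_nonneg x := by
    have := Λ.Q_nonneg x
    rw [IntegralLattice.Q] at this
    simpa using (by linarith : 0 ≤ Λ.B x x)
  add_left x y z := by simp
  smul_left x y r := by simp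
  definite x h := by
    by_contra hx
    exact (Λ.posDef x hx).ne' h

/-- With `B` as inner product, `2 Q` is the squared norm and the lattice bound applies. -/
theorem IntegralLattice.summable_exp_neg_Q (x : V) {y : ℝ} (hy : 0 < y) :
    Summable fun v : Λ.L => Real.exp (-(y * Λ.Q (v - x))) := by
  obtain ⟨m, b, hb⟩ := Λ.isLattice
  let _ : NormedAddCommGroup V := Λ.innerCore.toNormedAddCommGroup
  let _ : InnerProductSpace ℝ V := InnerProductSpace.ofCore Λ.innerCore.toCore
  have : FiniteDimensional ℝ V := b.finiteDimensional_of_finite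
  have h1 := summable_exp_neg_norm_sq (Submodule.span ℤ (Set.range b)) x
    (by positivity : 0 < y / 2)
  have hmem : ∀ v : V, v ∈ Λ.L ↔ v ∈ Submodule.span ℤ (Set.range b) := fun v => by
    rw [hb, ← Submodule.mem_toAddSubgroup, Submodule.span_int_eq_addSubgroupClosure]
  refine ((Equiv.subtypeEquivRight hmem).summable_iff.2 h1).congr fun v => ?_
  have h2 : ‖(v : V) - x‖ ^ 2 = Λ.B (v - x) (v - x) := by
    rw [← real_inner_self_eq_norm_sq]; rfl
  simp only [Function.comp_apply, Equiv.subtypeEquivRight_apply_coe, h2, IntegralLattice.Q]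
  congr 1
  ring

theorem IntegralLattice.Q_add (s t : V) : Λ.Q (s + t) = Λ.Q s + Λ.Q t + Λ.B s t := by
  simp only [IntegralLattice.Q, map_add, LinearMap.add_apply, Λ.symm t s]; ring

theorem IntegralLattice.Q_neg (t : V) : Λ.Q (-t) = Λ.Q t := by
  simp [IntegralLattice.Q]

/-- Completing the square: `s B(t, e) - y Q(t) = (s²/y) Q(e) - y Q(t - (s/y) e)`, which reduces the
claim to a shifted Gaussian sum. -/
theorem IntegralLattice.expSummable (a e : V) :
    ExpSummable (fun v : Λ.L => Λ.Q (a + v)) (fun v => Λ.B (a + v) e) fun _ => (1 : ℂ) := by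
  intro y hy s
  have h1 := (Λ.summable_exp_neg_Q ((s / y) • e - a) (by positivity : 0 < 2 * Real.pi * y)).mul_left
    (Real.exp (2 * Real.pi * (s ^ 2 / y * Λ.Q e)))
  refine h1.congr fun v => ?_
  rw [← Real.exp_add, norm_one, mul_one]
  congr 1
  have : (v : V) - ((s / y) • e - a) = (a + v) + (-(s / y)) • e := by module
  rw [this, Λ.Q_add]
  simp only [IntegralLattice.Q, map_smul, LinearMap.smul_apply, smul_eq_mul]
  field_simp
  ring

/-- The theta series `∑ B(a + v, e) ^ j q ^ Q(a + v)`, where `v` runs over the lattice. -/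
def theta (a e : V) (j : ℕ) (x : ℂ) : ℂ :=
  ∑' v : Λ.L, (Λ.B (a + v) e : ℂ) ^ j * expo (Λ.Q (a + v) * x)

theorem IntegralLattice.expSummable_pow (a e : V) (j : ℕ) :
    ExpSummable (fun v : Λ.L => Λ.Q (a + v)) (fun v => Λ.B (a + v) e)
      fun v => (Λ.B (a + v) e : ℂ) ^ j := by
  induction j with
  | zero => simpa using Λ.expSummable a e
  | succ j ih => simpa [pow_succ'] using ih.smul_snd 1

theorem theta_eq_expSum (a e : V) (j : ℕ) (x : ℂ) :
    theta Λ a e j x = expSum (fun v : Λ.L => Λ.Q (a + v)) (fun v => Λ.B (a + v) e)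
      (fun v => (Λ.B (a + v) e : ℂ) ^ j) x 0 := by
  simp [theta, expSum, mul_comm]

theorem hasSum_theta (a e : V) (j : ℕ) {x : ℂ} (hx : 0 < x.im) :
    HasSum (fun v : Λ.L => (Λ.B (a + v) e : ℂ) ^ j * expo (Λ.Q (a + v) * x))
      (theta Λ a e j x) := by
  rw [theta_eq_expSum]
  simpa [mul_comm] using (Λ.expSummable_pow a e j).hasSum hx 0

theorem differentiableOn_theta (a e : V) (j : ℕ) :
    DifferentiableOn ℂ (theta Λ a e j) {x | 0 < x.im} := by
  intro x hx
  rw [funext (theta_eq_expSum Λ a e j)]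
  exact ((Λ.expSummable_pow a e j).hasDerivAt_fst hx 0).differentiableAt.differentiableWithinAt

theorem theta_neg (a e : V) (j : ℕ) (x : ℂ) :
    theta Λ (-a) e j x = (-1) ^ j * theta Λ a e j x := by
  rw [theta, theta, ← tsum_mul_left, ← (Equiv.neg Λ.L).tsum_eq]
  refine tsum_congr fun v => ?_
  have : -a + (((Equiv.neg Λ.L) v : Λ.L) : V) = -(a + v) := by simp; abel
  rw [this, Λ.Q_neg, ← mul_assoc, ← mul_pow]
  simp

theorem theta_zero_one (e : V) (x : ℂ) : theta Λ 0 e 1 x = 0 := by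
  have h := theta_neg Λ 0 e 1 x
  rw [neg_zero, pow_one] at h
  linear_combination h / 2

/-- The theta series at the point `i y`, as a real number. -/
def thetaR (a e : V) (j : ℕ) (y : ℝ) : ℝ :=
  ∑' v : Λ.L, Λ.B (a + v) e ^ j * Real.exp (-(2 * Real.pi * y * Λ.Q (a + v)))

theorem theta_term_I (Q y β : ℝ) (j : ℕ) : (β : ℂ) ^ j * expo (Q * (y * Complex.I)) =
    ((β ^ j * Real.exp (-(2 * Real.pi * y * Q)) : ℝ) : ℂ) := by
  rw [expo]
  push_cast
  congr 2
  linear_combination (2 * Real.pi * Q * y : ℂ) * Complex.I_mul_I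

/-- On the imaginary axis the series are real, so they can be compared by inequalities. -/
theorem theta_I (a e : V) (j : ℕ) (y : ℝ) :
    theta Λ a e j (y * Complex.I) = thetaR Λ a e j y := by
  simp only [theta, thetaR, theta_term_I, Complex.ofReal_tsum]

theorem summable_thetaR (a e : V) (j : ℕ) {y : ℝ} (hy : 0 < y) :
    Summable fun v : Λ.L => Λ.B (a + v) e ^ j * Real.exp (-(2 * Real.pi * y * Λ.Q (a + v))) := by
  have h := (hasSum_theta Λ a e j (x := y * Complex.I) (by simpa using hy)).summable
  simp only [theta_term_I] at h
  exact_mod_cast h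

theorem IntegralLattice.half_le_Q {v : V} (hv : v ∈ Λ.L) (h : v ≠ 0) : 1 / 2 ≤ Λ.Q v := by
  obtain ⟨m, hm⟩ := Λ.integral v hv v hv
  have h1 := Λ.posDef v h
  rw [hm] at h1
  have h2 : (1 : ℤ) ≤ m := by exact_mod_cast h1
  have h3 : (1 : ℝ) ≤ m := by exact_mod_cast h2
  rw [IntegralLattice.Q, hm]
  linarith

theorem one_le_thetaR_zero (e : V) {y : ℝ} (hy : 0 < y) : 1 ≤ thetaR Λ 0 e 0 y := by
  have := (summable_thetaR Λ 0 e 0 hy).le_tsum (0 : Λ.L) fun v _ => by positivity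
  refine le_trans (le_of_eq ?_) this
  simp [IntegralLattice.Q]

theorem thetaR_nonneg (a e : V) {j : ℕ} (hj : Even j) (y : ℝ) : 0 ≤ thetaR Λ a e j y :=
  tsum_nonneg fun _ => mul_nonneg (hj.pow_nonneg _) (Real.exp_pos _).le

theorem le_thetaR_two {a w : V} (hw : w - a ∈ Λ.L) (e : V) {y : ℝ} (hy : 0 < y) :
    Λ.B w e ^ 2 * Real.exp (-(2 * Real.pi * y * Λ.Q w)) ≤ thetaR Λ a e 2 y := by
  have := (summable_thetaR Λ a e 2 hy).le_tsum (⟨w - a, hw⟩ : Λ.L) fun v _ => by positivity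
  refine le_trans (le_of_eq ?_) this
  simp

/-- Since `Q ≥ M` on the coset, passing from height `1` to `y` multiplies each term by at most
`e^{-2π(y-1)M}`. -/
theorem thetaR_zero_le {a : V} {M : ℝ} (hM : ∀ v ∈ Λ.L, M ≤ Λ.Q (a + v)) (e : V) {y : ℝ}
    (hy : 1 ≤ y) :
    thetaR Λ a e 0 y ≤ Real.exp (-(2 * Real.pi * (y - 1) * M)) * thetaR Λ a e 0 1 := by
  rw [thetaR, thetaR, ← tsum_mul_left]
  refine (summable_thetaR Λ a e 0 (by linarith)).tsum_le_tsum (fun v => ?_)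
    ((summable_thetaR Λ a e 0 one_pos).mul_left _)
  rw [pow_zero, one_mul, one_mul, ← Real.exp_add]
  refine Real.exp_le_exp.2 ?_
  have h1 := mul_nonneg (by positivity : 0 ≤ 2 * Real.pi)
    (mul_nonneg (sub_nonneg.2 hy) (sub_nonneg.2 (hM v v.2)))
  linarith

/-- The vector `0` has weight `B(0, e)² = 0`, and every other lattice vector has `Q ≥ 1/2` by
integrality, whence the extra decay `e^{-π(y-1)}`. -/
theorem thetaR_two_le (e : V) {y : ℝ} (hy : 1 ≤ y) :
    thetaR Λ 0 e 2 y ≤ Real.exp (-(Real.pi * (y - 1))) * thetaR Λ 0 e 2 1 := by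
  rw [thetaR, thetaR, ← tsum_mul_left]
  refine (summable_thetaR Λ 0 e 2 (by linarith)).tsum_le_tsum (fun v => ?_)
    ((summable_thetaR Λ 0 e 2 one_pos).mul_left _)
  rw [zero_add, mul_left_comm, ← Real.exp_add]
  by_cases hv : (v : V) = 0
  · simp [hv]
  · refine mul_le_mul_of_nonneg_left (Real.exp_le_exp.2 ?_) (sq_nonneg _)
    have h1 := mul_nonneg (by positivity : 0 ≤ 2 * Real.pi)
      (mul_nonneg (sub_nonneg.2 hy) (sub_nonneg.2 (Λ.half_le_Q v.2 hv)))
    linarith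

/-- The determinant of the theta series of orders zero and two of the cosets of `0` and `a`. -/
def thetaDet (a e : V) (x : ℂ) : ℂ :=
  theta Λ 0 e 0 x * theta Λ a e 2 x - theta Λ a e 0 x * theta Λ 0 e 2 x

theorem differentiableOn_thetaDet (a e : V) :
    DifferentiableOn ℂ (thetaDet Λ a e) {x | 0 < x.im} :=
  ((differentiableOn_theta Λ 0 e 0).mul (differentiableOn_theta Λ a e 2)).sub
    ((differentiableOn_theta Λ a e 0).mul (differentiableOn_theta Λ 0 e 2))

/-- At `i y` the first product is at least `B(w, e)² e^{-2πyQ(w)}`, already from the terms of `0`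
and `w`. The second is at most `K e^{-π(y-1)} e^{-2πyQ(w)}`, which is smaller for large `y`. -/
theorem exists_thetaDet_ne_zero {a w e : V} (hw : w - a ∈ Λ.L)
    (hmin : ∀ w', w' - a ∈ Λ.L → Λ.Q w ≤ Λ.Q w') (hwe : Λ.B w e ≠ 0) :
    ∃ x : ℂ, 0 < x.im ∧ thetaDet Λ a e x ≠ 0 := by
  set M := Λ.Q w with hMdef
  have hM : ∀ v ∈ Λ.L, M ≤ Λ.Q (a + v) := fun v hv => hmin _ (by simpa using hv)
  set K := Real.exp (2 * Real.pi * M) * thetaR Λ a e 0 1 * thetaR Λ 0 e 2 1 with hK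
  have hB : 0 < Λ.B w e ^ 2 := by positivity
  have hlim : Filter.Tendsto (fun y : ℝ => K * Real.exp (-(Real.pi * (y - 1)))) Filter.atTop
      (nhds (K * 0)) := by
    refine Filter.Tendsto.const_mul K ?_
    refine Real.tendsto_exp_neg_atTop_nhds_zero.comp ?_
    exact (Filter.tendsto_atTop_add_const_right _ (-1) Filter.tendsto_id).const_mul_atTop
      Real.pi_pos
  rw [mul_zero] at hlim
  obtain ⟨y, hy1, hy⟩ := ((Filter.eventually_ge_atTop (1 : ℝ)).and
    (hlim.eventually_lt_const hB)).exists
  have hy0 : 0 < y := by linarith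
  refine ⟨y * Complex.I, by simpa using hy0, ?_⟩
  rw [thetaDet, theta_I, theta_I, theta_I, theta_I]
  norm_cast
  refine ne_of_gt (sub_pos.2 ?_)
  have e1 : Real.exp (-(2 * Real.pi * (y - 1) * M)) =
      Real.exp (-(2 * Real.pi * y * M)) * Real.exp (2 * Real.pi * M) := by
    rw [← Real.exp_add]; congr 1; ring
  calc thetaR Λ a e 0 y * thetaR Λ 0 e 2 y
      ≤ (Real.exp (-(2 * Real.pi * (y - 1) * M)) * thetaR Λ a e 0 1) *
          (Real.exp (-(Real.pi * (y - 1))) * thetaR Λ 0 e 2 1) :=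
        mul_le_mul (thetaR_zero_le Λ hM e hy1) (thetaR_two_le Λ e hy1)
          (thetaR_nonneg Λ _ _ even_two _)
          (mul_nonneg (Real.exp_pos _).le (thetaR_nonneg Λ _ _ Even.zero _))
    _ = Real.exp (-(2 * Real.pi * y * M)) * (K * Real.exp (-(Real.pi * (y - 1)))) := by
        rw [e1, hK]; ring
    _ < Real.exp (-(2 * Real.pi * y * M)) * Λ.B w e ^ 2 :=
        mul_lt_mul_of_pos_left hy (Real.exp_pos _)
    _ = 1 * (Λ.B w e ^ 2 * Real.exp (-(2 * Real.pi * y * M))) := by ring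
    _ ≤ thetaR Λ 0 e 0 y * thetaR Λ a e 2 y :=
        mul_le_mul (one_le_thetaR_zero Λ e hy0) (le_thetaR_two Λ hw e hy0) (by positivity)
          (zero_le_one.trans (one_le_thetaR_zero Λ e hy0))

end Theta

/-! ### Linear systems of theta series and vanishing of Jacobi forms. -/

section Injectivity

variable {V : Type*} [AddCommGroup V] [Module ℝ V]
variable {W : Type*} [NormedAddCommGroup W] [NormedSpace ℂ W]
variable {Λ : IntegralLattice V}

theorem Disc_mk_eq_iff (x y : Λ.dual) :
    (QuotientAddGroup.mk x : Λ.Disc) = QuotientAddGroup.mk y ↔ (x : V) - y ∈ Λ.L := by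
  rw [QuotientAddGroup.eq, AddSubgroup.mem_addSubgroupOf, ← neg_mem_iff]
  simp [sub_eq_add_neg, add_comm]

theorem Disc_mk_eq_zero_iff (x : Λ.dual) :
    (QuotientAddGroup.mk x : Λ.Disc) = 0 ↔ (x : V) ∈ Λ.L := by
  rw [QuotientAddGroup.eq_zero_iff, AddSubgroup.mem_addSubgroupOf]

/-- The vectors `a r` represent the cosets of the lattice in its dual, without repetition. -/
structure IsRepSystem {ι : Type*} (Λ : IntegralLattice V) (a : ι → V) : Prop where
  inj : ∀ r s, a r - a s ∈ Λ.L → r = s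
  surj : ∀ t ∈ Λ.dual, ∃ r, t - a r ∈ Λ.L

theorem isRepSystem_two (hcard : Nat.card Λ.Disc = 2) {α : Λ.dual}
    (hα : ∀ x : Λ.Disc, x = 0 ∨ x = (QuotientAddGroup.mk α : Λ.Disc)) :
    IsRepSystem Λ ![0, (α : V)] := by
  have hαL : (α : V) ∉ Λ.L := fun h => by
    rw [← Disc_mk_eq_zero_iff] at h
    simp only [h, or_self] at hα
    have : Subsingleton Λ.Disc := ⟨fun x y => (hα x).trans (hα y).symm⟩
    have := Finite.card_le_one_iff_subsingleton.2 this
    omega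
  refine ⟨fun r s h => ?_, fun t ht => ?_⟩
  · fin_cases r <;> fin_cases s <;> simp at h ⊢ <;> exact hαL h
  · rcases hα (QuotientAddGroup.mk ⟨t, ht⟩) with h | h
    · exact ⟨0, by simpa using (Disc_mk_eq_zero_iff _).1 h⟩
    · exact ⟨1, by simpa using (Disc_mk_eq_iff _ _).1 h⟩

/-- The representatives `±α`, rather than `α` and `2α`, let the symmetry `v ↦ -v` separate even from
odd theta series. -/
theorem isRepSystem_three (hcard : Nat.card Λ.Disc = 3) {α : Λ.dual}
    (hα : ∀ x : Λ.Disc, x ∈ AddSubgroup.zmultiples (QuotientAddGroup.mk α : Λ.Disc)) :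
    IsRepSystem Λ ![0, (α : V), -(α : V)] := by
  have horder : addOrderOf (QuotientAddGroup.mk α : Λ.Disc) = 3 := by
    rw [← Nat.card_zmultiples, (AddSubgroup.eq_top_iff' _).2 hα, AddSubgroup.card_top, hcard]
  have h3 : (3 : ℤ) • (QuotientAddGroup.mk α : Λ.Disc) = 0 := by
    have := addOrderOf_nsmul_eq_zero (QuotientAddGroup.mk α : Λ.Disc)
    rw [horder] at this
    exact_mod_cast this
  have h1L : (α : V) ∉ Λ.L := fun h => by
    rw [← Disc_mk_eq_zero_iff, ← AddMonoid.addOrderOf_eq_one_iff] at h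
    omega
  -- This separates the cosets of `α` and `-α`: the class of `α` has order `3`, which does not
  -- divide `2`.
  have h2L : (α : V) + α ∉ Λ.L := fun h => by
    have h' : (QuotientAddGroup.mk (α + α) : Λ.Disc) = 0 := (Disc_mk_eq_zero_iff _).2 h
    have h'' : 2 • (QuotientAddGroup.mk α : Λ.Disc) = 0 := by rw [two_nsmul]; exact h'
    have := addOrderOf_dvd_of_nsmul_eq_zero h''
    rw [horder] at this
    omega
  refine ⟨fun r s h => ?_, fun t ht => ?_⟩
  · have h2L' : -(α : V) - α ∉ Λ.L := fun h => h2L (by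
      have := neg_mem h
      rwa [neg_sub, sub_neg_eq_add] at this)
    fin_cases r <;> fin_cases s <;> simp at h ⊢ <;>
      first | exact h1L h | exact h2L h | exact h2L' h
  · obtain ⟨k, hk⟩ := hα (QuotientAddGroup.mk ⟨t, ht⟩)
    simp only at hk
    have hk3 : (QuotientAddGroup.mk ⟨t, ht⟩ : Λ.Disc) = (k % 3) • QuotientAddGroup.mk α := by
      rw [← hk]
      conv_lhs => rw [← Int.emod_add_mul_ediv k 3, add_zsmul, mul_comm, mul_zsmul, h3, zsmul_zero,
        add_zero]
    have hcases : k % 3 = 0 ∨ k % 3 = 1 ∨ k % 3 = 2 := by omega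
    rcases hcases with h | h | h <;> rw [h] at hk3
    · rw [zero_zsmul] at hk3
      exact ⟨0, by simpa using (Disc_mk_eq_zero_iff _).1 hk3⟩
    · rw [one_zsmul] at hk3
      exact ⟨1, by simpa using (Disc_mk_eq_iff _ _).1 hk3⟩
    · have e : (2 : ℤ) • (QuotientAddGroup.mk α : Λ.Disc) = QuotientAddGroup.mk (-α) := by
        rw [QuotientAddGroup.mk_neg, eq_neg_iff_add_eq_zero]
        rw [← h3, ← one_zsmul (QuotientAddGroup.mk α : Λ.Disc), smul_smul, ← add_zsmul]
        norm_num
      rw [e] at hk3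
      exact ⟨2, by simpa using (Disc_mk_eq_iff _ _).1 hk3⟩

/-- The moments of a family on the dual lattice that transforms like the Fourier coefficients of a
Jacobi form are combinations of theta series. -/
theorem IsRepSystem.sum_theta_smul {ι : Type*} [Fintype ι] {a : ι → V} (ha : IsRepSystem Λ a)
    (τ : ℍ) {C : V → W} (hC : ∀ t, C t ≠ 0 → t ∈ Λ.dual)
    (hadd : ∀ t (v : Λ.L), C (t + v) = expo (τ * (Λ.Q v + Λ.B t v)) • C t) (e : V) (j : ℕ)
    {X : W} (hX : HasSum (fun t => (Λ.B t e : ℂ) ^ j • C t) X) :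
    ∑ r, theta Λ (a r) e j τ • expo (-(τ * Λ.Q (a r))) • C (a r) = X := by
  -- Pairs of a representative and a lattice vector parametrize the dual lattice, outside which `C`
  -- vanishes; the sum can therefore be split by cosets.
  have hinj : Function.Injective fun p : ι × Λ.L => a p.1 + p.2 := by
    rintro ⟨r, v⟩ ⟨s, w⟩ h
    simp only at h
    obtain rfl : r = s := ha.inj r s (by
      rw [show a r - a s = w - v by rw [sub_eq_sub_iff_add_eq_add, h, add_comm]]
      exact sub_mem w.2 v.2)
    rw [add_right_inj] at h
    rw [Subtype.ext h]
  have h1 := (hinj.hasSum_iff (fun t ht => ?_)).2 hX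
  · refine (hasSum_fintype _).unique (h1.prod_fiberwise fun r => ?_)
    refine ((hasSum_theta Λ (a r) e j τ.im_pos).smul_const
      (expo (-(τ * Λ.Q (a r))) • C (a r))).congr_fun fun v => ?_
    simp only [Function.comp_apply, hadd, smul_smul, mul_assoc, ← expo_add]
    congr 3
    rw [Λ.Q_add]
    push_cast
    ring
  · rw [smul_eq_zero]
    right
    by_contra hne
    obtain ⟨r, hr⟩ := ha.surj t (hC t hne)
    exact ht ⟨(r, ⟨_, hr⟩), by simp⟩

theorem IsRepSystem.eq_zero {ι : Type*} {a : ι → V} (ha : IsRepSystem Λ a)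
    (τ : ℍ) {C : V → W} (hC : ∀ t, C t ≠ 0 → t ∈ Λ.dual)
    (hadd : ∀ t (v : Λ.L), C (t + v) = expo (τ * (Λ.Q v + Λ.B t v)) • C t)
    (h0 : ∀ r, C (a r) = 0) (t : V) : C t = 0 := by
  by_contra hne
  obtain ⟨r, hr⟩ := ha.surj t (hC t hne)
  have := hadd (a r) ⟨_, hr⟩
  rw [h0, smul_zero] at this
  exact hne (by simpa using this)

variable {φ : ℍ × (ℂ ⊗[ℝ] V) → W} {c : ℚ × V → W} {n : ℕ} {κ : ℤ}
  {b : Module.Basis (Fin (n + 1)) ℝ V}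

theorem HasJSum.moment_zero [FiniteDimensional ℂ W] (h : HasJSum Λ c φ)
    (h0 : opD Λ b κ 0 φ = 0) (τ : ℍ) (e : V) :
    HasSum (fun t => (Λ.B t e : ℂ) ^ 0 • fiberCoeff c τ t) 0 := by
  have : CompleteSpace W := FiniteDimensional.complete ℂ W
  have h1 := h.hasSum_fiberCoeff τ 0
  rw [← opD_zero Λ b κ φ, h0] at h1
  simpa [expo_zero] using h1

theorem HasJSum.moment_one [FiniteDimensional ℂ W] (h : HasJSum Λ c φ)
    (h1 : opD Λ b κ (Pi.single (Fin.last n) 1) φ = 0) (τ : ℍ) :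
    HasSum (fun t => (Λ.B t (b (Fin.last n)) : ℂ) ^ 1 • fiberCoeff c τ t) 0 := by
  have : CompleteSpace W := FiniteDimensional.complete ℂ W
  have hne : (2 * Real.pi * Complex.I : ℂ) ≠ 0 := by simp [Real.pi_ne_zero]
  have h2 := (isJetOp_one (W := W) b κ).hasSum h τ
  rw [h1] at h2
  have h3 := (JacobiTaylor.hasSum_fiberCoeff h
    (l := fun t => 2 * Real.pi * Complex.I * (Λ.B t (b (Fin.last n)) : ℝ)) h2).const_smul
    (2 * Real.pi * Complex.I : ℂ)⁻¹
  rw [Pi.zero_apply, smul_zero] at h3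
  refine h3.congr_fun fun t => ?_
  rw [smul_smul, pow_one, inv_mul_cancel_left₀ hne]

/-- Vanishing of `φ(τ, 0)` for all `τ` removes the `τ`-derivative, leaving `κ` times the second
derivative in `z`. -/
theorem HasJSum.moment_two [FiniteDimensional ℂ W] (h : HasJSum Λ c φ) (hκ : κ ≠ 0)
    (h0 : opD Λ b κ 0 φ = 0)
    (h2 : opD Λ b κ (Pi.single (Fin.last n) 2) φ = 0) (τ : ℍ) :
    HasSum (fun t => (Λ.B t (b (Fin.last n)) : ℂ) ^ 2 • fiberCoeff c τ t) 0 := by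
  have : CompleteSpace W := FiniteDimensional.complete ℂ W
  have hne : ((2 * Real.pi * Complex.I) ^ 2 : ℂ) ≠ 0 := by simp [Real.pi_ne_zero]
  have hz : dTau (fun τ => φ (τ, 0)) τ = 0 := by
    have : (fun τ => φ (τ, 0)) = 0 := (funext fun τ => opD_zero Λ b κ φ τ).symm.trans h0
    rw [this]
    simp [dTau]
  have h3 := congrFun h2 τ
  rw [opD_single_two, hz, smul_zero, sub_zero, h.deriv_deriv_snd, Pi.zero_apply, smul_eq_zero,
    Int.cast_eq_zero] at h3
  have h4 := (((h.expSummable_zero (b (Fin.last n))).smul_snd (2 * Real.pi * Complex.I)).smul_snd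
      (2 * Real.pi * Complex.I)).hasSum_zero τ
  have h5 := (JacobiTaylor.hasSum_fiberCoeff h (τ := τ) (f := 0)
    (l := fun t => (2 * Real.pi * Complex.I * (Λ.B t (b (Fin.last n)) : ℝ)) ^ 2) (by
      rw [← h3.resolve_left hκ]
      refine h4.congr_fun fun p => ?_
      rw [smul_smul (2 * Real.pi * Complex.I * _ : ℂ), ← sq])).const_smul
    ((2 * Real.pi * Complex.I) ^ 2 : ℂ)⁻¹
  rw [smul_zero] at h5
  refine h5.congr_fun fun t => ?_
  rw [smul_smul, mul_pow _ (Λ.B t (b (Fin.last n)) : ℂ), inv_mul_cancel_left₀ hne]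

/-- The identity theorem on the connected upper half plane: a factor that is not identically zero
may be cancelled. -/
theorem smul_eq_zero_on_upperHalfPlane [CompleteSpace W] {g : ℂ → ℂ} {f : ℂ → W}
    (hg : DifferentiableOn ℂ g {x | 0 < x.im}) (hf : DifferentiableOn ℂ f {x | 0 < x.im})
    (hne : ∃ x : ℂ, 0 < x.im ∧ g x ≠ 0) (h : ∀ x : ℂ, 0 < x.im → g x • f x = 0) :
    ∀ x : ℂ, 0 < x.im → f x = 0 := by
  have hU : IsOpen {x : ℂ | 0 < x.im} := isOpen_lt continuous_const Complex.continuous_im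
  have hpre : IsPreconnected {x : ℂ | 0 < x.im} := (convex_halfSpace_im_gt 0).isPreconnected
  rcases AnalyticOnNhd.eq_zero_or_eq_zero_of_smul_eq_zero (hg.analyticOnNhd hU)
    (hf.analyticOnNhd hU) h hpre with h1 | h1
  · obtain ⟨x, hx, hgx⟩ := hne
    exact absurd (h1 x hx) hgx
  · exact h1

theorem HasJSum.differentiableOn_fst [FiniteDimensional ℂ W] (h : HasJSum Λ c φ)
    (z : ℂ ⊗[ℝ] V) :
    DifferentiableOn ℂ (fun x => φ (UpperHalfPlane.ofComplex x, z)) {x | 0 < x.im} := by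
  have : CompleteSpace W := FiniteDimensional.complete ℂ W
  have e := fun τ => h.eq_expSum 0 z τ 0
  simp only [TensorProduct.zero_tmul, add_zero] at e
  simp only [e]
  exact (h.expSummable 0 z).holoH

variable {G : Subgroup SL(2, ℤ)} {ρ : Representation ℂ (jacobiGroup Λ G) W}

/-- The zeroth and second moments give two equations for the two cosets, with determinant
`thetaDet`. -/
theorem eq_zero_of_opD_two [FiniteDimensional ℂ W] (hκ : κ ≠ 0)
    (hv : ∀ v : Λ.L, ρ (heis Λ G v 0 1 (one_pow 2)) = 1)
    (hw : ∀ v : Λ.L, ρ (heis Λ G 0 v 1 (one_pow 2)) = 1)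
    {a : V} (ha : IsRepSystem Λ ![0, a])
    (hmin : ∃ w : V, w - a ∈ Λ.L ∧ (∀ w' : V, w' - a ∈ Λ.L → Λ.Q w ≤ Λ.Q w') ∧
      Λ.B w (b (Fin.last n)) ≠ 0)
    (hφ : φ ∈ jacobiFormHol Λ κ G ρ) (h : HasJSum Λ c φ) (h0 : opD Λ b κ 0 φ = 0)
    (h2 : opD Λ b κ (Pi.single (Fin.last n) 2) φ = 0) : φ = 0 := by
  have : CompleteSpace W := FiniteDimensional.complete ℂ W
  obtain ⟨w, hw1, hw2, hw3⟩ := hmin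
  set e := b (Fin.last n) with he
  -- With the determinant as a factor the identity holds at every `τ`, also where the system is
  -- singular; it is cancelled afterwards as a holomorphic function.
  have key : ∀ (τ : ℍ) z, thetaDet Λ a e τ • φ (τ, z) = 0 := by
    intro τ z
    by_cases hD : thetaDet Λ a e τ = 0
    · rw [hD, zero_smul]
    have hC := fun t => fiberCoeff_mem_dual (t := t) hw hφ h τ
    have hadd := fiberCoeff_add hv hφ h τ
    have e0 := ha.sum_theta_smul τ hC hadd e 0 (h.moment_zero h0 τ e)
    have e2 := ha.sum_theta_smul τ hC hadd e 2 (h.moment_two hκ h0 h2 τ)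
    simp only [Fin.sum_univ_two, Matrix.cons_val_zero, Matrix.cons_val_one] at e0 e2
    have hs := h.hasSum_fiberCoeff τ z
    have hzero : ∀ t, fiberCoeff c τ t = 0 := by
      refine ha.eq_zero τ hC hadd fun r => ?_
      have hne := expo_ne_zero
      -- Cramer's rule, written as a combination of the two equations; the other coset is treated
      -- likewise.
      have hX : thetaDet Λ a e τ • expo (-(τ * Λ.Q 0)) • fiberCoeff c τ 0 = 0 := by
        have := congrArg₂ (fun x y => theta Λ a e 2 τ • x - theta Λ a e 0 τ • y) e0 e2
        simp only [smul_zero, sub_zero] at this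
        rw [← this, thetaDet]
        module
      have hY : thetaDet Λ a e τ • expo (-(τ * Λ.Q a)) • fiberCoeff c τ a = 0 := by
        have := congrArg₂ (fun x y => theta Λ 0 e 0 τ • y - theta Λ 0 e 2 τ • x) e0 e2
        simp only [smul_zero, sub_zero] at this
        rw [← this, thetaDet]
        module
      simp only [smul_eq_zero, hD, hne, false_or] at hX hY
      fin_cases r
      · exact hX
      · exact hY
    simp only [hzero, smul_zero] at hs
    rw [hs.unique hasSum_zero, smul_zero]
  funext x
  obtain ⟨τ, z⟩ := x
  have := smul_eq_zero_on_upperHalfPlane (differentiableOn_thetaDet Λ a e)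
    (h.differentiableOn_fst z) (exists_thetaDet_ne_zero Λ hw1 hw2 hw3)
    (fun x hx => by simpa [coe_ofComplex hx] using key (UpperHalfPlane.ofComplex x) z) τ τ.im_pos
  simpa [UpperHalfPlane.ofComplex_apply] using this

/-- The first moment has no contribution from the trivial coset and opposite ones from `±a`. Once it
has identified those two unknowns, the even moments form a system of two equations. -/
theorem eq_zero_of_opD_three [FiniteDimensional ℂ W] (hκ : κ ≠ 0)
    (hv : ∀ v : Λ.L, ρ (heis Λ G v 0 1 (one_pow 2)) = 1)
    (hw : ∀ v : Λ.L, ρ (heis Λ G 0 v 1 (one_pow 2)) = 1)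
    {a : V} (ha : IsRepSystem Λ ![0, a, -a])
    (hmin : ∃ w : V, w - a ∈ Λ.L ∧ (∀ w' : V, w' - a ∈ Λ.L → Λ.Q w ≤ Λ.Q w') ∧
      Λ.B w (b (Fin.last n)) ≠ 0)
    (hθ : ∃ τ : ℍ, theta Λ a (b (Fin.last n)) 1 τ ≠ 0)
    (hφ : φ ∈ jacobiFormHol Λ κ G ρ) (h : HasJSum Λ c φ) (h0 : opD Λ b κ 0 φ = 0)
    (h1 : opD Λ b κ (Pi.single (Fin.last n) 1) φ = 0)
    (h2 : opD Λ b κ (Pi.single (Fin.last n) 2) φ = 0) : φ = 0 := by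
  have : CompleteSpace W := FiniteDimensional.complete ℂ W
  obtain ⟨w, hw1, hw2, hw3⟩ := hmin
  set e := b (Fin.last n) with he
  have key : ∀ (τ : ℍ) z, thetaDet Λ a e τ • theta Λ a e 1 τ • φ (τ, z) = 0 := by
    intro τ z
    by_cases hD : thetaDet Λ a e τ = 0
    · rw [hD, zero_smul]
    by_cases hS : theta Λ a e 1 τ = 0
    · rw [hS, zero_smul, smul_zero]
    have hC := fun t => fiberCoeff_mem_dual (t := t) hw hφ h τ
    have hadd := fiberCoeff_add hv hφ h τ
    have e0 := ha.sum_theta_smul τ hC hadd e 0 (h.moment_zero h0 τ e)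
    have e1 := ha.sum_theta_smul τ hC hadd e 1 (h.moment_one h1 τ)
    have e2 := ha.sum_theta_smul τ hC hadd e 2 (h.moment_two hκ h0 h2 τ)
    simp only [Fin.sum_univ_three, Matrix.cons_val_zero, Matrix.cons_val_one, Matrix.cons_val,
      theta_neg, theta_zero_one] at e0 e1 e2
    have hs := h.hasSum_fiberCoeff τ z
    have hzero : ∀ t, fiberCoeff c τ t = 0 := by
      refine ha.eq_zero τ hC hadd fun r => ?_
      have hne := expo_ne_zero
      generalize hX : expo (-(τ * Λ.Q 0)) • fiberCoeff c τ 0 = X at e0 e1 e2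
      generalize hY : expo (-(τ * Λ.Q a)) • fiberCoeff c τ a = Y at e0 e1 e2
      generalize hZ : expo (-(τ * Λ.Q (-a))) • fiberCoeff c τ (-a) = Z at e0 e1 e2
      -- The odd equation reads `θ (Y - Z) = 0`, with `θ` the first-order theta series of `a`.
      have hYZ : Y = Z := by
        have : theta Λ a e 1 τ • (Y - Z) = 0 := by rw [← e1]; module
        exact sub_eq_zero.1 ((smul_eq_zero.1 this).resolve_left hS)
      subst hYZ
      have hX0 : thetaDet Λ a e τ • X = 0 := by
        have := congrArg₂ (fun x y => theta Λ a e 2 τ • x - theta Λ a e 0 τ • y) e0 e2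
        simp only [smul_zero, sub_zero] at this
        rw [← this, thetaDet]
        module
      have hY0 : thetaDet Λ a e τ • Y = 0 := by
        -- The cosets of `a` and `-a` contribute equally, so Cramer's rule yields twice the
        -- determinant; the `1/2` removes this factor.
        have := congrArg₂ (fun x y => (1 / 2 : ℂ) • (theta Λ 0 e 0 τ • y - theta Λ 0 e 2 τ • x))
          e0 e2
        simp only [smul_zero, sub_zero] at this
        rw [← this, thetaDet]
        module
      have hX0 := (smul_eq_zero.1 hX0).resolve_left hD
      have hY0 := (smul_eq_zero.1 hY0).resolve_left hD
      rw [hX0, smul_eq_zero] at hX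
      rw [hY0, smul_eq_zero] at hY hZ
      fin_cases r
      · exact hX.resolve_left (hne _)
      · exact hY.resolve_left (hne _)
      · exact hZ.resolve_left (hne _)
    simp only [hzero, smul_zero] at hs
    rw [hs.unique hasSum_zero, smul_zero, smul_zero]
  obtain ⟨τ₀, hτ₀⟩ := hθ
  funext x
  obtain ⟨τ, z⟩ := x
  have hf := h.differentiableOn_fst z
  have hS := differentiableOn_theta Λ a e 1
  -- Two cancellations: here the determinant, next the odd theta series.
  have step := smul_eq_zero_on_upperHalfPlane (differentiableOn_thetaDet Λ a e)
    (hS.smul hf) (exists_thetaDet_ne_zero Λ hw1 hw2 hw3)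
    (fun x hx => by simpa [coe_ofComplex hx] using key (UpperHalfPlane.ofComplex x) z)
  have := smul_eq_zero_on_upperHalfPlane hS hf ⟨τ₀, τ₀.im_pos, hτ₀⟩ step τ τ.im_pos
  simpa [UpperHalfPlane.ofComplex_apply] using this

end Injectivity

end JacobiTaylor

end

/-! ### The embeddings for discriminant groups of order three and two. -/

theorem mainTheorem7 {V : Type*} [AddCommGroup V] [Module ℝ V]
    {W : Type*} [NormedAddCommGroup W] [NormedSpace ℂ W] [FiniteDimensional ℂ W]
    {n : ℕ} (Λ : IntegralLattice V) (b : Module.Basis (Fin (n + 1)) ℝ V)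
    (G : Subgroup SL(2, ℤ)) (hG : G.FiniteIndex)
    -- the weight is `k = κ / 2`, and it is not one of `0, -1, -2, …`
    (κ : ℤ) (hκ : ∀ m : ℕ, κ ≠ -(2 * (m : ℤ)))
    (ρ : Representation ℂ (jacobiGroup Λ G) W) (hker : (MonoidHom.ker ρ).FiniteIndex)
    (hneg : ∀ (ξ : Circle) (hξ : ξ ^ 2 = 1), (ξ : ℂ) = -1 → ∀ x : W, ρ (heis Λ G 0 0 ξ hξ) x = -x)
    (hv : ∀ v : Λ.L, ρ (heis Λ G v 0 1 (one_pow 2)) = 1)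
    (hw : ∀ v : Λ.L, ρ (heis Λ G 0 v 1 (one_pow 2)) = 1) :
    -- determinant three
    (Nat.card Λ.Disc = 3 →
      ∀ α : Λ.dual, (∀ x : Λ.Disc, x ∈ AddSubgroup.zmultiples (QuotientAddGroup.mk α : Λ.Disc)) →
      (∃ w : V, w - α ∈ Λ.L ∧ (∀ w' : V, w' - α ∈ Λ.L → Λ.Q w ≤ Λ.Q w') ∧
        Λ.B w (b (Fin.last n)) ≠ 0) →
      (∃ τ : ℍ, ∑' v : Λ.L, (Λ.B (α + v) (b (Fin.last n)) : ℂ) * expo (Λ.Q (α + v) * τ) ≠ 0) →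
      (∃ F : jacobiFormWHol Λ κ G ρ →ₗ[ℂ]
          modFormWHol κ G (ρ.comp (mpEmbed Λ G)) × modFormWHol (κ + 2) G (ρ.comp (mpEmbed Λ G)) ×
            modFormWHol (κ + 4) G (ρ.comp (mpEmbed Λ G)),
        Function.Injective F ∧ ∀ φ,
          ((F φ).1 : ℍ → W) = opD Λ b κ 0 φ ∧
          ((F φ).2.1 : ℍ → W) = opD Λ b κ (Pi.single (Fin.last n) 1) φ ∧
          ((F φ).2.2 : ℍ → W) = opD Λ b κ (Pi.single (Fin.last n) 2) φ) ∧
      (∃ F : jacobiFormWeak Λ κ G ρ →ₗ[ℂ]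
          modForm κ G (ρ.comp (mpEmbed Λ G)) × modForm (κ + 2) G (ρ.comp (mpEmbed Λ G)) ×
            modForm (κ + 4) G (ρ.comp (mpEmbed Λ G)),
        Function.Injective F ∧ ∀ φ,
          ((F φ).1 : ℍ → W) = opD Λ b κ 0 φ ∧
          ((F φ).2.1 : ℍ → W) = opD Λ b κ (Pi.single (Fin.last n) 1) φ ∧
          ((F φ).2.2 : ℍ → W) = opD Λ b κ (Pi.single (Fin.last n) 2) φ) ∧
      (∃ F : jacobiForm Λ κ G ρ →ₗ[ℂ]
          modForm κ G (ρ.comp (mpEmbed Λ G)) × cuspForm (κ + 2) G (ρ.comp (mpEmbed Λ G)) ×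
            cuspForm (κ + 4) G (ρ.comp (mpEmbed Λ G)),
        Function.Injective F ∧ ∀ φ,
          ((F φ).1 : ℍ → W) = opD Λ b κ 0 φ ∧
          ((F φ).2.1 : ℍ → W) = opD Λ b κ (Pi.single (Fin.last n) 1) φ ∧
          ((F φ).2.2 : ℍ → W) = opD Λ b κ (Pi.single (Fin.last n) 2) φ)) ∧
    -- determinant two
    (Nat.card Λ.Disc = 2 →
      ∀ α : Λ.dual, (∀ x : Λ.Disc, x = 0 ∨ x = (QuotientAddGroup.mk α : Λ.Disc)) →
      (∃ w : V, w - α ∈ Λ.L ∧ (∀ w' : V, w' - α ∈ Λ.L → Λ.Q w ≤ Λ.Q w') ∧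
        Λ.B w (b (Fin.last n)) ≠ 0) →
      (∃ F : jacobiFormWHol Λ κ G ρ →ₗ[ℂ]
          modFormWHol κ G (ρ.comp (mpEmbed Λ G)) × modFormWHol (κ + 4) G (ρ.comp (mpEmbed Λ G)),
        Function.Injective F ∧ ∀ φ,
          ((F φ).1 : ℍ → W) = opD Λ b κ 0 φ ∧
          ((F φ).2 : ℍ → W) = opD Λ b κ (Pi.single (Fin.last n) 2) φ) ∧
      (∃ F : jacobiFormWeak Λ κ G ρ →ₗ[ℂ]
          modForm κ G (ρ.comp (mpEmbed Λ G)) × modForm (κ + 4) G (ρ.comp (mpEmbed Λ G)),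
        Function.Injective F ∧ ∀ φ,
          ((F φ).1 : ℍ → W) = opD Λ b κ 0 φ ∧
          ((F φ).2 : ℍ → W) = opD Λ b κ (Pi.single (Fin.last n) 2) φ) ∧
      (∃ F : jacobiForm Λ κ G ρ →ₗ[ℂ]
          modForm κ G (ρ.comp (mpEmbed Λ G)) × cuspForm (κ + 4) G (ρ.comp (mpEmbed Λ G)),
        Function.Injective F ∧ ∀ φ,
          ((F φ).1 : ℍ → W) = opD Λ b κ 0 φ ∧
          ((F φ).2 : ℍ → W) = opD Λ b κ (Pi.single (Fin.last n) 2) φ)) := by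
  have hκ0 : κ ≠ 0 := by simpa using hκ 0
  have hWH : ∀ φ ∈ jacobiFormWHol Λ κ G ρ, ∃ c, HasJSum Λ c φ :=
    fun φ hφ => exists_hasJSum_of_mem_wHol hφ
  have hWk : ∀ φ ∈ jacobiFormWeak Λ κ G ρ, ∃ c, HasJSum Λ c φ :=
    fun φ hφ => exists_hasJSum_of_mem hφ
  have hJ : ∀ φ ∈ jacobiForm Λ κ G ρ, ∃ c, HasJSum Λ c φ :=
    fun φ hφ => exists_hasJSum_of_mem hφ
  have weak : ∀ {κ' : ℤ} {D : (ℍ × (ℂ ⊗[ℝ] V) → W) → ℍ → W} {l : ℚ × V → ℂ},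
      IsJetOp Λ κ κ' D l → ∀ φ ∈ jacobiFormWeak Λ κ G ρ, D φ ∈ modForm κ' G (ρ.comp (mpEmbed Λ G)) :=
    fun hD φ hφ => hD.mem_modFormOf (P := fun m _ => 0 ≤ m) (fun _ _ h _ => h) hφ
  have D0 := isJetOp_zero (Λ := Λ) (W := W) b κ
  have D1 := isJetOp_one (Λ := Λ) (W := W) b κ
  have D2 := isJetOp_two (Λ := Λ) (W := W) b κ
  -- The two weights vanish at `t = 0` and at `(m, t) = (0, 0)` respectively. On the remaining
  -- support `m ≥ Q(t)` forces `m > 0`, which makes the images cusp forms.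
  have c1 : ∀ (m : ℚ) (t : V), 0 ≤ (m : ℝ) - Λ.Q t →
      (2 * Real.pi * Complex.I * (Λ.B t (b (Fin.last n)) : ℝ) : ℂ) ≠ 0 → 0 < m := by
    refine fun m t h hne => pos_of_Q_le h (Or.inr ?_)
    rintro rfl
    exact hne (by simp)
  have c2 : ∀ (m : ℚ) (t : V), 0 ≤ (m : ℝ) - Λ.Q t →
      (κ * (2 * Real.pi * Complex.I * (Λ.B t (b (Fin.last n)) : ℝ)) ^ 2 -
        4 * Real.pi * Complex.I * Λ.B (b (Fin.last n)) (b (Fin.last n)) *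
          (2 * Real.pi * Complex.I * m) : ℂ) ≠ 0 → 0 < m := by
    refine fun m t h hne => pos_of_Q_le h ?_
    by_contra! hmt
    obtain ⟨rfl, rfl⟩ := hmt
    exact hne (by simp)
  refine ⟨fun hcard α hα hmin hθ => ?_, fun hcard α hα hmin => ?_⟩
  · have ha := isRepSystem_three hcard hα
    have hθ' : ∃ τ : ℍ, theta Λ α (b (Fin.last n)) 1 τ ≠ 0 := by
      simpa only [theta, pow_one] using hθ
    -- Vanishing uses only the transformation law and some convergent expansion, so one argument
    -- serves all three kinds of Jacobi forms.
    have hinj : ∀ φ ∈ jacobiFormHol Λ κ G ρ, (∃ c, HasJSum Λ c φ) → opD Λ b κ 0 φ = 0 →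
        opD Λ b κ (Pi.single (Fin.last n) 1) φ = 0 →
        opD Λ b κ (Pi.single (Fin.last n) 2) φ = 0 → φ = 0 := fun φ hφ ⟨c, h⟩ h0 h1 h2 =>
      eq_zero_of_opD_three hκ0 hv hw ha hmin hθ' hφ h h0 h1 h2
    refine ⟨⟨(D0.toLin hWH fun φ hφ => D0.mem_modFormWHol hφ).prod
        ((D1.toLin hWH fun φ hφ => D1.mem_modFormWHol hφ).prod
          (D2.toLin hWH fun φ hφ => D2.mem_modFormWHol hφ)), ?_, fun φ => ⟨rfl, rfl, rfl⟩⟩,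
      ⟨(D0.toLin hWk (weak D0)).prod
        ((D1.toLin hWk (weak D1)).prod
          (D2.toLin hWk (weak D2))), ?_,
        fun φ => ⟨rfl, rfl, rfl⟩⟩,
      ⟨(D0.toLin hJ fun φ hφ => D0.mem_modFormOf (fun _ _ h _ => nonneg_of_Q_le h) hφ).prod
        ((D1.toLin hJ fun φ hφ => D1.mem_modFormOf c1 hφ).prod
          (D2.toLin hJ fun φ hφ => D2.mem_modFormOf c2 hφ)), ?_, fun φ => ⟨rfl, rfl, rfl⟩⟩⟩
    · refine (injective_iff_map_eq_zero _).2 fun φ h => Subtype.ext ?_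
      exact hinj φ φ.2.1 (hWH φ φ.2) (congrArg (fun x => (x.1 : ℍ → W)) h)
        (congrArg (fun x => (x.2.1 : ℍ → W)) h) (congrArg (fun x => (x.2.2 : ℍ → W)) h)
    · refine (injective_iff_map_eq_zero _).2 fun φ h => Subtype.ext ?_
      exact hinj φ φ.2.1 (hWk φ φ.2) (congrArg (fun x => (x.1 : ℍ → W)) h)
        (congrArg (fun x => (x.2.1 : ℍ → W)) h) (congrArg (fun x => (x.2.2 : ℍ → W)) h)
    · refine (injective_iff_map_eq_zero _).2 fun φ h => Subtype.ext ?_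
      exact hinj φ φ.2.1 (hJ φ φ.2) (congrArg (fun x => (x.1 : ℍ → W)) h)
        (congrArg (fun x => (x.2.1 : ℍ → W)) h) (congrArg (fun x => (x.2.2 : ℍ → W)) h)
  · have ha := isRepSystem_two hcard hα
    have hinj : ∀ φ ∈ jacobiFormHol Λ κ G ρ, (∃ c, HasJSum Λ c φ) → opD Λ b κ 0 φ = 0 →
        opD Λ b κ (Pi.single (Fin.last n) 2) φ = 0 → φ = 0 := fun φ hφ ⟨c, h⟩ h0 h2 =>
      eq_zero_of_opD_two hκ0 hv hw ha hmin hφ h h0 h2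
    refine ⟨⟨(D0.toLin hWH fun φ hφ => D0.mem_modFormWHol hφ).prod
          (D2.toLin hWH fun φ hφ => D2.mem_modFormWHol hφ), ?_, fun φ => ⟨rfl, rfl⟩⟩,
      ⟨(D0.toLin hWk (weak D0)).prod
          (D2.toLin hWk (weak D2)), ?_,
        fun φ => ⟨rfl, rfl⟩⟩,
      ⟨(D0.toLin hJ fun φ hφ => D0.mem_modFormOf (fun _ _ h _ => nonneg_of_Q_le h) hφ).prod
          (D2.toLin hJ fun φ hφ => D2.mem_modFormOf c2 hφ), ?_, fun φ => ⟨rfl, rfl⟩⟩⟩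
    · refine (injective_iff_map_eq_zero _).2 fun φ h => Subtype.ext ?_
      exact hinj φ φ.2.1 (hWH φ φ.2) (congrArg (fun x => (x.1 : ℍ → W)) h)
        (congrArg (fun x => (x.2 : ℍ → W)) h)
    · refine (injective_iff_map_eq_zero _).2 fun φ h => Subtype.ext ?_
      exact hinj φ φ.2.1 (hWk φ φ.2) (congrArg (fun x => (x.1 : ℍ → W)) h)
        (congrArg (fun x => (x.2 : ℍ → W)) h)
    · refine (injective_iff_map_eq_zero _).2 fun φ h => Subtype.ext ?_
      exact hinj φ φ.2.1 (hJ φ φ.2) (congrArg (fun x => (x.1 : ℍ → W)) h)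
        (congrArg (fun x => (x.2 : ℍ → W)) h)
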